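/- **Setting.** Let $\Lambda\ge 1$, let $\mathcal H$ be a complex Hilbert space and let $H(s)=\sum_{k=1}^{\Lambda}H_k(s)$, $s\in\mathbb R$, where each $H_k$ is a $C^\infty$ map into the bounded operators on $\mathcal H$. Let $U_{\mathrm{ex}}(t',t)=\exp_{\mathcal T}\big(-i\int_t^{t'}H(s)\,ds\big)$ be the time-ordered exponential (the sum of the Dyson series). Let $n,q\ge 1$, and let $a_1,\dots,a_{q+1}$, $b_1,\dots,b_q$ be real numbers such that, for any two operators $A,B$ on a finite-dimensional Hilbert space, as $x\to0$ in $\mathbb R$, $$e^{(A+B)x}=e^{Aa_1x}e^{Bb_1x}\cdots e^{Aa_qx}e^{Bb_qx}e^{Aa_{q+1}x}+O(x^{n+1}).$$ Put $c_1=a_1$, $c_k=a_k-d_{k-1}$ for $2\le k\le q$, and $d_k=b_k-c_k$ for $1\le k\le q$. For $1\le k\le q$ put $L_k=\Delta t\sum_{j=k}^q(c_j+d_j)$ and $R_k=\Delta t\big(d_k+\sum_{j=k+1}^q(c_j+d_j)\big)$, and let $L_{q+1}=0$. Write $\prod_{k=1}^{\Lambda}X_k=X_1\cdots X_\Lambda$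 and $\prod_{k=\Lambda}^{1}X_k=X_\Lambda\cdots X_1$. Fix $\Lambda'\in\{0,\dots,\Lambda\}$ and define $$U_F(t',t)=\prod_{k=1}^{\Lambda'}e^{-i(t'-t)H_k(t')}\prod_{k=\Lambda'+1}^{\Lambda}e^{-i(t'-t)H_k(t)},\qquad U_B(t',t)=\prod_{k=\Lambda}^{\Lambda'+1}e^{-i(t'-t)H_k(t')}\prod_{k=\Lambda'}^{1}e^{-i(t'-t)H_k(t)},$$ $$U_n(t+\Delta t,t)=\prod_{j=1}^{q}U_F(t+L_j,t+R_j)\,U_B(t+R_j,t+L_{j+1}).$$ **Theorem.** 1. *Order.* $U_n(t+\Delta t,t)-U_{\mathrm{ex}}(t+\Delta t,t)=O(\Delta t^{n+1})$ as $\Delta t\to0$, locally uniformly in $t$. 2. *Gates.* A gate is one query to $e^{-i\tau H_k(\alpha)}$ (index $k$, time $\alpha$, duration $\tau$). Written out, $U_n$ consists of $2\Lambda q$ gates. Merge each maximal run of consecutive gates that query the same generator (the same $k$ and the same time, given as $t+\sigma\Delta t$ with fixed $\sigma$) into one gate. The merged circuit still implements $U_n(t+\Delta t,t)$. It has - exactly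 $2\Lambda q-(2q-1)$ gates if $\Lambda'\ne0$ and $\Lambda'\neq\Lambda$; - at most $2\Lambda q-q$ gates if $\Lambda'=0$, with equality if $a_j\ne0$ for $2\le j\le q$; - at most $2\Lambda q-(q-1)$ gates if $\Lambda'=\Lambda$, with equality if $b_j\neq0$ for $1\le j\le q$. For time-independent $h_1,\dots,h_\Lambda$, merging consecutive gates with the same $h_k$ in the time-independent scheme $\prod_{j=1}^q\big(\prod_{k=1}^{\Lambda}e^{-ic_j\Delta t\,h_k}\big)\big(\prod_{k=\Lambda}^{1}e^{-id_j\Delta t\,h_k}\big)$ preserves the operator and leaves exactly $2\Lambda q-(2q-1)$ gates. 3. *Digitized adiabatic simulation.* If $H_k(s)=f_k(s)h_k$ with real functions $f_k$, then for every $\Lambda'$ merging consecutive gates with the same $h_k$ leaves exactly $2\Lambda q-(2q-1)$ gates $e^{-i\theta h_k}$ that implement $U_n(t+\Delta t,t)$. The same operator is also a product of $2\Lambda q-(2q-1)$ queries of the form $e^{-i\tau H_k(\alpha)}$. 4. *Minimum-gate formulas.* Let $0<\Lambda'<\Lambda$. Call a product of $N$ factors $e^{-i\tau_i\Delta t\,h_{k_i}}$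 (respectively $e^{-i\tau_i\Delta t\,H_{k_i}(t+\sigma_i\Delta t)}$), with fixed $1\le k_i\le\Lambda$ and $\tau_i,\sigma_i\in\mathbb R$, an order-$n$ time-independent (respectively time-dependent) formula if it approximates the evolution with error $O(\Delta t^{n+1})$, in the time-dependent case locally uniformly in $t$, for all self-adjoint (respectively smooth self-adjoint) Hamiltonians with $\Lambda$ terms on finite-dimensional Hilbert spaces. Then the merged circuit of $U_n$ is an order-$n$ time-dependent formula. If $2\Lambda q-(2q-1)$ is the minimum number of gates of an order-$n$ time-independent formula, then it is also the minimum number of gates of an order-$n$ time-dependent formula. Moreover, for the Forest–Ruth–Suzuki coefficients $\gamma=(2-2^{1/3})^{-1}$, $(a_1,\dots,a_4)=(\frac\gamma2,\frac{1-\gamma}2,\frac{1-\gamma}2,\frac\gamma2)$, $(b_1,b_2,b_3)=(\gamma,1-2\gamma,\gamma)$ and $\Lambda=2$, $\Lambda'=1$, the merged circuit has $7$ gates and the scheme equals $$e^{-i\frac{\gamma\Delta t}{2}H_1(t+\Delta t)}e^{-i\gamma\Delta tH_2(t+(1-\frac\gamma2)\Delta t)}e^{-i\frac{(1-\gamma)\Delta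 t}2H_1(t+(1-\gamma)\Delta t)}e^{-i(1-2\gamma)\Delta tH_2(t+\frac{\Delta t}2)}e^{-i\frac{(1-\gamma)\Delta t}2H_1(t+\gamma\Delta t)}e^{-i\gamma\Delta tH_2(t+\frac{\gamma\Delta t}2)}e^{-i\frac{\gamma\Delta t}2H_1(t)}.$$ 5. *Suzuki's scheme.* If $\Lambda'=0$ and $c_j=d_j$ for $1\le j\le q$, then $U_n(t+\Delta t,t)=\prod_{j=1}^{q}S(t+L_j,t+L_{j+1})$, where $$S(t',t)=\prod_{k=1}^{\Lambda}e^{-i\frac{t'-t}2H_k(\frac{t+t'}2)}\prod_{k=\Lambda}^{1}e^{-i\frac{t'-t}2H_k(\frac{t+t'}2)}$$ is the midpoint scheme. -/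

import Mathlib

open Filter Topology Asymptotics
open scoped ContDiff

/-- The ordered product `f m * f (m+1) * ⋯ * f n` (empty, hence `1`, if `n < m`). -/
def forwardProd {M : Type*} [Monoid M] (m n : ℕ) (f : ℕ → M) : M :=
  ((List.range' m (n + 1 - m)).map f).prod

/-- The ordered product `f n * ⋯ * f (m+1) * f m` (empty, hence `1`, if `n < m`). -/
def backwardProd {M : Type*} [Monoid M] (n m : ℕ) (f : ℕ → M) : M :=
  ((List.range' m (n + 1 - m)).reverse.map f).prod

section Coefficients

/-- The coefficients `d₁, d₂, …` with `c₁ = a₁`, `cₖ = aₖ - dₖ₋₁`, `dₖ = bₖ - cₖ`;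
the value `d₀ = 0` is a convention. -/
def coeffD (a b : ℕ → ℝ) : ℕ → ℝ
  | 0 => 0
  | k + 1 => b (k + 1) - (a (k + 1) - coeffD a b k)

/-- The coefficients `c₁ = a₁`, `cₖ = aₖ - dₖ₋₁` for `k ≥ 2`; the value at `0` is unused. -/
def coeffC (a b : ℕ → ℝ) : ℕ → ℝ
  | 0 => 0
  | k + 1 => a (k + 1) - coeffD a b k

/-- `L_k = Δt * ∑_{j=k}^{q} (c_j + d_j)`; in particular `L_{q+1} = 0`. -/
def nodeL (q : ℕ) (a b : ℕ → ℝ) (Δt : ℝ) (k : ℕ) : ℝ :=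
  Δt * ∑ j ∈ Finset.Icc k q, (coeffC a b j + coeffD a b j)

/-- `R_k = Δt * (d_k + ∑_{j=k+1}^{q} (c_j + d_j))`. -/
def nodeR (q : ℕ) (a b : ℕ → ℝ) (Δt : ℝ) (k : ℕ) : ℝ :=
  Δt * (coeffD a b k + ∑ j ∈ Finset.Icc (k + 1) q, (coeffC a b j + coeffD a b j))

/-- The `q`-cycle product formula with coefficients `a₁, …, a_{q+1}` and `b₁, …, b_q` has order `n`:
`e^{(A+B)x} = e^{A a₁ x} e^{B b₁ x} ⋯ e^{B b_q x} e^{A a_{q+1} x} + O(x^{n+1})`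
for any two operators `A`, `B` on a finite-dimensional Hilbert space. -/
def IsProductFormulaOfOrder (n q : ℕ) (a b : ℕ → ℝ) : Prop :=
  ∀ (m : ℕ) (A B : EuclideanSpace ℂ (Fin m) →L[ℂ] EuclideanSpace ℂ (Fin m)),
    (fun x : ℝ =>
      NormedSpace.exp ((x : ℂ) • (A + B)) -
        forwardProd 1 q (fun j => NormedSpace.exp (((a j * x : ℝ) : ℂ) • A) *
            NormedSpace.exp (((b j * x : ℝ) : ℂ) • B)) *
          NormedSpace.exp (((a (q + 1) * x : ℝ) : ℂ) • A))
      =O[𝓝 0] fun x : ℝ => x ^ (n + 1)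

end Coefficients

section Evolution

variable {𝓗 : Type*} [NormedAddCommGroup 𝓗] [InnerProductSpace ℂ 𝓗]

/-- `e^{-iτA}`. -/
noncomputable def evolve (A : 𝓗 →L[ℂ] 𝓗) (τ : ℝ) : 𝓗 →L[ℂ] 𝓗 :=
  NormedSpace.exp ((-(Complex.I * (τ : ℂ))) • A)

/-- The terms of the Dyson series of `exp_𝒯 (-i ∫_s^t H)`: the `0`-th one is `1`, and the
`(j+1)`-st one is `∫_s^t (-i) H(r) D_j(r, s) dr`. -/
noncomputable def dysonTerm (H : ℝ → 𝓗 →L[ℂ] 𝓗) (s : ℝ) : ℕ → ℝ → 𝓗 →L[ℂ] 𝓗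
  | 0, _ => 1
  | j + 1, t => ∫ r in s..t, (-Complex.I) • (H r * dysonTerm H s j r)

/-- The time-ordered exponential `exp_𝒯 (-i ∫_s^t H(r) dr)`, as the sum of its Dyson series. -/
noncomputable def timeOrderedExp (H : ℝ → 𝓗 →L[ℂ] 𝓗) (t s : ℝ) : 𝓗 →L[ℂ] 𝓗 :=
  ∑' j : ℕ, dysonTerm H s j t

/-- The one-step map `V t Δt` approximates the exact evolution of `H = ∑_{k=1}^Λ H_k` from `t` to
`t + Δt` to order `n`: the error is `O(Δt^{n+1})` as `Δt → 0`, locally uniformly in `t`. -/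
def ApproximatesToOrder (n Λ : ℕ) (H : ℕ → ℝ → 𝓗 →L[ℂ] 𝓗) (V : ℝ → ℝ → 𝓗 →L[ℂ] 𝓗) : Prop :=
  ∀ t₀ : ℝ,
    (fun p : ℝ × ℝ =>
      V p.1 p.2 - timeOrderedExp (fun s => ∑ k ∈ Finset.Icc 1 Λ, H k s) (p.1 + p.2) p.1)
      =O[𝓝 (t₀, 0)] fun p : ℝ × ℝ => p.2 ^ (n + 1)

/-- `U_F(t', t) = ∏_{k=1}^{Λ'} e^{-i(t'-t)H_k(t')} ∏_{k=Λ'+1}^{Λ} e^{-i(t'-t)H_k(t)}`. -/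
noncomputable def blockF (Λ Λ' : ℕ) (H : ℕ → ℝ → 𝓗 →L[ℂ] 𝓗) (t' t : ℝ) : 𝓗 →L[ℂ] 𝓗 :=
  forwardProd 1 Λ' (fun k => evolve (H k t') (t' - t)) *
    forwardProd (Λ' + 1) Λ (fun k => evolve (H k t) (t' - t))

/-- `U_B(t', t) = ∏_{k=Λ}^{Λ'+1} e^{-i(t'-t)H_k(t')} ∏_{k=Λ'}^{1} e^{-i(t'-t)H_k(t)}`. -/
noncomputable def blockB (Λ Λ' : ℕ) (H : ℕ → ℝ → 𝓗 →L[ℂ] 𝓗) (t' t : ℝ) : 𝓗 →L[ℂ] 𝓗 :=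
  backwardProd Λ (Λ' + 1) (fun k => evolve (H k t') (t' - t)) *
    backwardProd Λ' 1 (fun k => evolve (H k t) (t' - t))

/-- The time-dependent scheme `U_n(t + Δt, t)`, the ordered product over `j = 1, …, q` of
`U_F(t + L_j, t + R_j) U_B(t + R_j, t + L_{j+1})`. -/
noncomputable def timeDepScheme (q Λ Λ' : ℕ) (a b : ℕ → ℝ) (H : ℕ → ℝ → 𝓗 →L[ℂ] 𝓗)
    (t Δt : ℝ) : 𝓗 →L[ℂ] 𝓗 :=
  forwardProd 1 q fun j =>
    blockF Λ Λ' H (t + nodeL q a b Δt j) (t + nodeR q a b Δt j) *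
      blockB Λ Λ' H (t + nodeR q a b Δt j) (t + nodeL q a b Δt (j + 1))

/-- The time-independent scheme for `∑_{k=1}^Λ h_k`: the ordered product over `j = 1, …, q` of
`(∏_{k=1}^{Λ} e^{-i c_j Δt h_k}) (∏_{k=Λ}^{1} e^{-i d_j Δt h_k})`. -/
noncomputable def timeIndepScheme (q Λ : ℕ) (a b : ℕ → ℝ) (h : ℕ → 𝓗 →L[ℂ] 𝓗)
    (Δt : ℝ) : 𝓗 →L[ℂ] 𝓗 :=
  forwardProd 1 q fun j =>
    forwardProd 1 Λ (fun k => evolve (h k) (coeffC a b j * Δt)) *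
      backwardProd Λ 1 (fun k => evolve (h k) (coeffD a b j * Δt))

/-- The midpoint scheme
`∏_{k=1}^{Λ} e^{-i(t'-t)/2 H_k((t+t')/2)} ∏_{k=Λ}^{1} e^{-i(t'-t)/2 H_k((t+t')/2)}`. -/
noncomputable def midpointScheme (Λ : ℕ) (H : ℕ → ℝ → 𝓗 →L[ℂ] 𝓗) (t' t : ℝ) : 𝓗 →L[ℂ] 𝓗 :=
  forwardProd 1 Λ (fun k => evolve (H k ((t + t') / 2)) ((t' - t) / 2)) *
    backwardProd Λ 1 (fun k => evolve (H k ((t + t') / 2)) ((t' - t) / 2))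

end Evolution

section Circuits

/-- A gate: one query to `e^{-iτG}`, where `τ` is the duration and the label selects the generator
`G`. A circuit is a list of gates, the leftmost factor of the operator product coming first. -/
structure Gate (ι : Type*) where
  /-- the generator that is queried -/
  label : ι
  /-- the duration of the query -/
  duration : ℝ

open Classical in
/-- Put a gate in front of a circuit; if the first gate of the circuit has the same generator, the
two gates become one. -/
noncomputable def consGate {ι : Type*} (g : Gate ι) : List (Gate ι) → List (Gate ι)
  | [] => [g]
  | g' :: l =>
    if g.label = g'.label then ⟨g.label, g.duration + g'.duration⟩ :: l else g :: g' :: l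

/-- Merge each maximal run of consecutive gates with the same generator into a single gate. -/
noncomputable def mergeGates {ι : Type*} (l : List (Gate ι)) : List (Gate ι) :=
  l.foldr consGate []

/-- The operator that a circuit implements, `G` being the family of generators. -/
noncomputable def runGates {ι 𝓗 : Type*} [NormedAddCommGroup 𝓗] [InnerProductSpace ℂ 𝓗]
    (G : ι → 𝓗 →L[ℂ] 𝓗) (l : List (Gate ι)) : 𝓗 →L[ℂ] 𝓗 :=
  (l.map fun g => evolve (G g.label) g.duration).prod

/-- The queries in `U_F(t', t)`; the label `(k, α)` stands for the generator `H_k(α)`. -/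
def gatesF (Λ Λ' : ℕ) (t' t : ℝ) : List (Gate (ℕ × ℝ)) :=
  (List.range' 1 Λ').map (fun k => ⟨(k, t'), t' - t⟩) ++
    (List.range' (Λ' + 1) (Λ - Λ')).map (fun k => ⟨(k, t), t' - t⟩)

/-- The queries in `U_B(t', t)`. -/
def gatesB (Λ Λ' : ℕ) (t' t : ℝ) : List (Gate (ℕ × ℝ)) :=
  (List.range' (Λ' + 1) (Λ - Λ')).reverse.map (fun k => ⟨(k, t'), t' - t⟩) ++
    (List.range' 1 Λ').reverse.map (fun k => ⟨(k, t), t' - t⟩)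

/-- The `2Λq` queries in the time-dependent scheme, for `t = 0` and `Δt = 1`. -/
def timeDepGates (q Λ Λ' : ℕ) (a b : ℕ → ℝ) : List (Gate (ℕ × ℝ)) :=
  (List.range' 1 q).flatMap fun j =>
    gatesF Λ Λ' (nodeL q a b 1 j) (nodeR q a b 1 j) ++
      gatesB Λ Λ' (nodeR q a b 1 j) (nodeL q a b 1 (j + 1))

/-- Rescale a circuit from the step `[0, 1]` to the step from `t` to `t + Δt`. -/
def atStep (t Δt : ℝ) (l : List (Gate (ℕ × ℝ))) : List (Gate (ℕ × ℝ)) :=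
  l.map fun g => ⟨(g.label.1, t + g.label.2 * Δt), g.duration * Δt⟩

/-- The `2Λq` queries in the time-independent scheme, for `Δt = 1`; the label `k` stands for the
generator `h_k`. -/
def timeIndepGates (q Λ : ℕ) (a b : ℕ → ℝ) : List (Gate ℕ) :=
  (List.range' 1 q).flatMap fun j =>
    (List.range' 1 Λ).map (fun k => ⟨k, coeffC a b j⟩) ++
      (List.range' 1 Λ).reverse.map (fun k => ⟨k, coeffD a b j⟩)

/-- Rescale all durations by `Δt`. -/
def scaleGates (Δt : ℝ) (l : List (Gate ℕ)) : List (Gate ℕ) :=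
  l.map fun g => ⟨g.label, g.duration * Δt⟩

/-- If `H_k(s) = f_k(s) h_k`, then a query to `e^{-iτH_k(α)}` is a query to `e^{-iτ f_k(α) h_k}`. -/
def separableGates (f : ℕ → ℝ → ℝ) (l : List (Gate (ℕ × ℝ))) : List (Gate ℕ) :=
  l.map fun g => ⟨g.label.1, g.duration * f g.label.1 g.label.2⟩

/-- A circuit of queries `e^{-iτ Δt h_k}`, `1 ≤ k ≤ Λ`, is a time-independent formula of order `n`
for Hamiltonians `∑_{k=1}^Λ h_k` on finite-dimensional Hilbert spaces. -/
def IsTimeIndepFormula (n Λ : ℕ) (l : List (Gate ℕ)) : Prop :=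
  (∀ g ∈ l, g.label ∈ Finset.Icc 1 Λ) ∧
  ∀ (m : ℕ) (h : ℕ → EuclideanSpace ℂ (Fin m) →L[ℂ] EuclideanSpace ℂ (Fin m)),
    (∀ k ∈ Finset.Icc 1 Λ, IsSelfAdjoint (h k)) →
      (fun x : ℝ => runGates h (scaleGates x l) - evolve (∑ k ∈ Finset.Icc 1 Λ, h k) x)
        =O[𝓝 0] fun x : ℝ => x ^ (n + 1)

/-- A circuit of queries `e^{-iτ Δt H_k(t + σ Δt)}`, `1 ≤ k ≤ Λ`, is a time-dependent formula of
order `n` for smooth Hamiltonians `∑_{k=1}^Λ H_k(s)` on finite-dimensional Hilbert spaces. -/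
def IsTimeDepFormula (n Λ : ℕ) (l : List (Gate (ℕ × ℝ))) : Prop :=
  (∀ g ∈ l, g.label.1 ∈ Finset.Icc 1 Λ) ∧
  ∀ (m : ℕ) (H : ℕ → ℝ → EuclideanSpace ℂ (Fin m) →L[ℂ] EuclideanSpace ℂ (Fin m)),
    (∀ k ∈ Finset.Icc 1 Λ, ContDiff ℝ ∞ (H k) ∧ ∀ s, IsSelfAdjoint (H k s)) →
      ApproximatesToOrder n Λ H (fun t Δt => runGates (Function.uncurry H) (atStep t Δt l))

end Circuits

section ForestRuthSuzuki

/-- `γ = (2 - 2^{1/3})⁻¹`. -/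
noncomputable def frsGamma : ℝ := (2 - (2 : ℝ) ^ (1 / 3 : ℝ))⁻¹

/-- `a₁, …, a₄` of the formula
`e^{X+Y} ≈ e^{γ/2 X} e^{γ Y} e^{(1-γ)/2 X} e^{(1-2γ) Y} e^{(1-γ)/2 X} e^{γ Y} e^{γ/2 X}`. -/
noncomputable def frsA (j : ℕ) : ℝ :=
  if j = 1 ∨ j = 4 then frsGamma / 2 else (1 - frsGamma) / 2

/-- `b₁, b₂, b₃` of the same formula. -/
noncomputable def frsB (j : ℕ) : ℝ :=
  if j = 1 ∨ j = 3 then frsGamma else 1 - 2 * frsGamma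

end ForestRuthSuzuki

/-!
Two facts carry the order statement. First, `U_B(t', t) = U_F(t, t')⁻¹`, so the scheme composes the
one-step method `U_F` with its adjoint. Second, such a composition is itself a splitting into two
flows: consider the functions `f(u, v)` of two times and put `F = U_F`. The flow
`f ↦ f(u, v + x)` moves the second time and the flow `f ↦ f(u + x, v) F(u + x, v) F(u, v)⁻¹` the
first one. Alternating them for durations `a₁Δt, b₁Δt, …, b_qΔt, a_{q+1}Δt`, starting from the
function `1` and evaluating at the diagonal point `(t, t)`, gives exactly the scheme
(`composeFlows_eq_forwardProd`). On the diagonal the sum of the two generators is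
`f ↦ f' - i f H`, the generator of the exact evolution (`isBigO_exact_sub_taylor`).

It remains to use the order of the product formula for these two generators, which are unbounded
operators on an infinite-dimensional space. Up to order `n` the order conditions are identities
between polynomials in two non-commuting variables, and the coefficient of each word can be read off
as an entry of suitable shift matrices (`lift_wordShift_apply`); hence the assumption about matrices
implies the identities in every algebra (`IsProductFormulaOfOrder.coeff_formalProd`). Since all
flows have Taylor expansions with locally uniform remainders (`isBigO_flow_sub_taylor`) and such
expansions can be composed (`HasExpansion.flow`), the formal identities give the error bound.

For the number of gates, a merged circuit has as many gates as its list of labels has runs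
(`length_mergeGates`). The labels zigzag through `1, …, Λ, Λ, …, 1, 1, …`, so gates can only be
merged at the turning points (`numRuns_zigzag_add`), where the two times agree always or exactly
when a coefficient vanishes (`length_mergeGates_timeDepGates`). Minimality is inherited by restricting
a time-dependent formula to constant Hamiltonians (`IsTimeDepFormula.exists_timeIndep`).
-/

/-! ### Asymptotic expansions of flows -/

/-- A bound on the `x`-derivative of a function that vanishes at `x = 0` integrates to a bound of
the next order, locally uniformly in the parameter `p` (mean value inequality). -/
theorem isBigO_pow_succ_of_hasDerivAt {E V : Type*} [TopologicalSpace E] [NormedAddCommGroup V]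
    [NormedSpace ℝ V] {φ φ' : ℝ × E → V} {p₀ : E} {N : ℕ} (h0 : ∀ p, φ (0, p) = 0)
    (hd : ∀ x p, HasDerivAt (fun y => φ (y, p)) (φ' (x, p)) x)
    (hO : φ' =O[𝓝 (0, p₀)] fun z => z.1 ^ N) :
    φ =O[𝓝 (0, p₀)] fun z => z.1 ^ (N + 1) := by
  obtain ⟨C, hC0, hC⟩ := hO.exists_nonneg
  have hC := hC.bound
  rw [nhds_prod_eq, Filter.eventually_prod_iff] at hC
  obtain ⟨P, hP, Q, hQ, hPQ⟩ := hC
  obtain ⟨δ, hδ, hball⟩ := Metric.eventually_nhds_iff_ball.1 hP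
  refine IsBigO.of_bound C ?_
  rw [nhds_prod_eq, Filter.eventually_prod_iff]
  refine ⟨_, Metric.ball_mem_nhds (0 : ℝ) hδ, Q, hQ, ?_⟩
  intro x hx p hp
  have hx' : |x| < δ := by simpa [Metric.ball, dist_eq_norm] using hx
  have key : ‖φ (x, p) - φ (0, p)‖ ≤ (C * |x| ^ N) * ‖x - 0‖ := by
    refine (convex_uIcc (0 : ℝ) x).norm_image_sub_le_of_norm_hasDerivWithin_le
      (f := fun y => φ (y, p)) (f' := fun y => φ' (y, p))
      (fun y _ => (hd y p).hasDerivWithinAt) ?_ Set.left_mem_uIcc Set.right_mem_uIcc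
    intro y hy
    have hy' : |y| ≤ |x| := by
      have := Set.abs_sub_left_of_mem_uIcc hy
      simpa using this
    have hyb : y ∈ Metric.ball (0 : ℝ) δ := by
      simpa [Metric.ball, dist_eq_norm] using lt_of_le_of_lt hy' hx'
    have h1 := hPQ (hball y hyb) hp
    have h2 : ‖φ' (y, p)‖ ≤ C * |y| ^ N := by simpa using h1
    exact h2.trans (by gcongr)
  rw [h0, sub_zero, sub_zero] at key
  simpa [pow_succ, mul_assoc] using key

/-- Taylor's formula for an abstract flow `Φ` with generator `X`: if `Φ_x f` has the `x`-derivative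
`Φ_x (X f)`, then it is approximated by the partial sums of `∑ x^k/k! X^k f`, locally uniformly in
the point of evaluation. Neither `M` nor `X` needs a linear structure. -/
theorem isBigO_flow_sub_taylor {M E V : Type*} [TopologicalSpace E] [NormedAddCommGroup V]
    [NormedSpace ℝ V] (X : M → M) (ev : M → E → V) (Φ : M → ℝ → E → V)
    (h0 : ∀ f p, Φ f 0 p = ev f p)
    (hd : ∀ f x p, HasDerivAt (fun y => Φ f y p) (Φ (X f) x p) x)
    (hb : ∀ f p₀, (fun z : ℝ × E => Φ f z.1 z.2) =O[𝓝 (0, p₀)] fun _ => (1 : ℝ))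
    (N : ℕ) (f : M) (p₀ : E) :
    (fun z : ℝ × E => Φ f z.1 z.2 -
        ∑ k ∈ Finset.range N, (z.1 ^ k / (k.factorial : ℝ)) • ev (X^[k] f) z.2)
      =O[𝓝 (0, p₀)] fun z => z.1 ^ N := by
  induction N generalizing f with
  | zero => simpa using hb f p₀
  | succ N ih =>
    refine isBigO_pow_succ_of_hasDerivAt
      (φ' := fun z : ℝ × E => Φ (X f) z.1 z.2 -
        ∑ k ∈ Finset.range N, (z.1 ^ k / (k.factorial : ℝ)) • ev (X^[k] (X f)) z.2) ?_ ?_ (ih (X f))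
    · intro p
      simp [Finset.sum_range_succ', h0]
    · intro x p
      refine (hd f x p).sub ?_
      have h1 : ∀ k ∈ Finset.range N, HasDerivAt
          (fun y : ℝ => (y ^ (k + 1) / ((k + 1).factorial : ℝ)) • ev (X^[k + 1] f) p)
          ((x ^ k / (k.factorial : ℝ)) • ev (X^[k] (X f)) p) x := by
        intro k _
        have h2 := ((hasDerivAt_pow (k + 1) x).div_const ((k + 1).factorial : ℝ)).smul_const
          (ev (X^[k + 1] f) p)
        convert h2 using 2
        · rw [Nat.factorial_succ, Nat.add_sub_cancel]
          push_cast
          field_simp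
        · rfl
      have h3 := (HasDerivAt.fun_sum h1).add_const
        ((x ^ 0 / (Nat.factorial 0 : ℝ)) • ev (X^[0] f) p)
      simpa [Finset.sum_range_succ' _ N] using h3

section Expansion

variable {M E V : Type*} [TopologicalSpace E] [NormedRing V] [NormedAlgebra ℝ V]
  [AddCommGroup M] [Module ℝ M]

/-- `ψ(x, p) = ∑_{k<N} x^k f_k(p) + O(x^N)` as `x → 0`, locally uniformly in `p`, where the
coefficients `f_k` are elements of a module `M` that is evaluated on `E` by `ev`. -/
def HasExpansion (N : ℕ) (ev : M →ₗ[ℝ] (E → V)) (ψ : ℝ → E → V) (f : ℕ → M) : Prop :=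
  ∀ p₀ : E, (fun z : ℝ × E => ψ z.1 z.2 - ∑ k ∈ Finset.range N, z.1 ^ k • ev (f k) z.2)
    =O[𝓝 (0, p₀)] fun z => z.1 ^ N

/-- An `x`-dependent operator on functions on `E`, namely `f ↦ f(π(x, p)) w(x, p)`, which to all
orders in `x` agrees with `exp(xX)` on the functions coming from `M`. -/
structure IsFlow (ev : M →ₗ[ℝ] (E → V)) (X : Module.End ℝ M) (π : ℝ → E → E)
    (w : ℝ → E → V) : Prop where
  continuousAt : ∀ p, ContinuousAt (fun z : ℝ × E => π z.1 z.2) (0, p)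
  map_zero : ∀ p, π 0 p = p
  isBigO_one : ∀ p₀, (fun z : ℝ × E => w z.1 z.2) =O[𝓝 (0, p₀)] fun _ => (1 : ℝ)
  taylor : ∀ (N : ℕ) (f : M) (p₀ : E),
    (fun z : ℝ × E => ev f (π z.1 z.2) * w z.1 z.2 -
        ∑ k ∈ Finset.range N, (z.1 ^ k / (k.factorial : ℝ)) • ev ((X ^ k) f) z.2)
      =O[𝓝 (0, p₀)] fun z => z.1 ^ N

/-- Applying a flow to an expansion multiplies the coefficients by the exponential series of its
generator (Cauchy product). The remainder survives because the flow only moves the point of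
evaluation continuously and multiplies by a bounded factor. -/
theorem HasExpansion.flow {N : ℕ} {ev : M →ₗ[ℝ] (E → V)} {ψ : ℝ → E → V} {f g : ℕ → M}
    (h : HasExpansion N ev ψ f) {X : Module.End ℝ M} {π : ℝ → E → E} {w : ℝ → E → V}
    (hX : IsFlow ev X π w) (α : ℝ)
    (hg : ∀ k, g k = ∑ i ∈ Finset.range (k + 1),
      (α ^ (k - i) / ((k - i).factorial : ℝ)) • (X ^ (k - i)) (f i)) :
    HasExpansion N ev (fun x p => ψ x (π (α * x) p) * w (α * x) p) g := by
  intro p₀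
  have hscale : Tendsto (fun z : ℝ × E => (α * z.1, z.2)) (𝓝 (0, p₀)) (𝓝 (0, p₀)) := by
    have : Continuous (fun z : ℝ × E => (α * z.1, z.2)) := by fun_prop
    simpa using this.tendsto (0, p₀)
  have hπ : Tendsto (fun z : ℝ × E => (z.1, π (α * z.1) z.2)) (𝓝 (0, p₀)) (𝓝 (0, p₀)) := by
    have h1 := (hX.continuousAt p₀).tendsto.comp hscale
    simp only [hX.map_zero] at h1
    exact (continuous_fst.tendsto' (0, p₀) 0 rfl).prodMk_nhds h1
  have hw := (hX.isBigO_one p₀).comp_tendsto hscale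
  have h1 := ((h p₀).comp_tendsto hπ).mul hw
  have h2 : ∀ i ∈ Finset.range N, (fun z : ℝ × E => z.1 ^ i •
      (ev (f i) (π (α * z.1) z.2) * w (α * z.1) z.2 - ∑ l ∈ Finset.range (N - i),
        ((α * z.1) ^ l / (l.factorial : ℝ)) • ev ((X ^ l) (f i)) z.2))
      =O[𝓝 (0, p₀)] fun z => z.1 ^ N := by
    intro i hi
    have h3 := (hX.taylor (N - i) (f i) p₀).comp_tendsto hscale
    have h4 : (fun z : ℝ × E => (α * z.1) ^ (N - i)) =O[𝓝 (0, p₀)] fun z => z.1 ^ (N - i) := by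
      simp only [mul_pow]
      exact (isBigO_refl _ _).const_mul_left _
    have h5 := (isBigO_refl (fun z : ℝ × E => z.1 ^ i) (𝓝 (0, p₀))).smul (h3.trans h4)
    refine h5.congr_right fun z => ?_
    simp only [smul_eq_mul, ← pow_add]
    congr 1
    have := Finset.mem_range.1 hi
    omega
  refine (((h1.congr_right (fun z => by simp)).add (IsBigO.sum h2))).congr_left ?_
  intro z
  simp only [Function.comp, sub_mul, Finset.sum_mul, smul_sub, Finset.sum_apply,
    Finset.sum_sub_distrib, smul_mul_assoc]
  rw [sub_add_sub_cancel]
  congr 1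
  simp only [Finset.smul_sum]
  rw [← Finset.sum_range_diag_flip N (fun i l => z.1 ^ i • ((α * z.1) ^ l / (l.factorial : ℝ)) •
    ev ((X ^ l) (f i)) z.2)]
  refine Finset.sum_congr rfl fun k _ => ?_
  rw [hg, map_sum, Finset.sum_apply, Finset.smul_sum]
  refine Finset.sum_congr rfl fun i hi => ?_
  rw [map_smul, Pi.smul_apply, smul_smul, smul_smul]
  congr 1
  have : k = i + (k - i) := by have := Finset.mem_range.1 hi; omega
  rw [mul_pow]
  conv_rhs => rw [this, pow_add]
  simp only [Nat.add_sub_cancel_left]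
  ring

theorem hasExpansion_const {N : ℕ} (ev : M →ₗ[ℝ] (E → V)) (m₀ : M)
    (hm : ∀ p₀, (fun z : ℝ × E => ev m₀ z.2) =O[𝓝 (0, p₀)] fun _ => (1 : ℝ)) :
    HasExpansion N ev (fun _ p => ev m₀ p) (fun k => if k = 0 then m₀ else 0) := by
  intro p₀
  cases N with
  | zero => simpa using hm p₀
  | succ N =>
    refine (isBigO_zero _ _).congr_left fun z => ?_
    simp [Finset.sum_range_succ']

end Expansion

/-! ### Formal products of exponentials -/

section FormalProduct

open MulOpposite PowerSeries

variable {R : Type*} [Semiring R] [Algebra ℝ R]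

/-- The formal power series `exp(α X x)` in `x`, for an element `X` of a not necessarily
commutative algebra. -/
noncomputable def formalExp (α : ℝ) (X : R) : PowerSeries R :=
  PowerSeries.mk fun k => (α ^ k / (k.factorial : ℝ)) • X ^ k

@[simp]
theorem coeff_formalExp (α : ℝ) (X : R) (k : ℕ) :
    coeff k (formalExp α X) = (α ^ k / (k.factorial : ℝ)) • X ^ k := by
  simp [formalExp]

/-- The formal power series `e^{A a₁ x} e^{B b₁ x} ⋯ e^{B b_q x} e^{A a_{q+1} x}`. -/
noncomputable def formalProd (a b : ℕ → ℝ) (A B : R) : ℕ → PowerSeries R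
  | 0 => formalExp (a 1) A
  | q + 1 => formalProd a b A B q * formalExp (b (q + 1)) B * formalExp (a (q + 2)) A

theorem map_formalExp {S : Type*} [Semiring S] [Algebra ℝ S] (φ : R →ₐ[ℝ] S) (α : ℝ) (X : R) :
    PowerSeries.map (φ : R →+* S) (formalExp α X) = formalExp α (φ X) := by
  ext k
  simp

theorem map_formalProd {S : Type*} [Semiring S] [Algebra ℝ S] (φ : R →ₐ[ℝ] S) (a b : ℕ → ℝ)
    (A B : R) (q : ℕ) :
    PowerSeries.map (φ : R →+* S) (formalProd a b A B q) = formalProd a b (φ A) (φ B) q := by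
  induction q with
  | zero => exact map_formalExp _ _ _
  | succ q ih => simp only [formalProd, map_mul, ih, map_formalExp]

theorem coeff_formalExp_map {S : Type*} [Semiring S] [Algebra ℝ S] (φ : R →ₐ[ℝ] S) (α : ℝ) (X : R)
    (k : ℕ) : coeff k (formalExp α (φ X)) = φ (coeff k (formalExp α X)) := by
  simp

theorem coeff_formalProd_map {S : Type*} [Semiring S] [Algebra ℝ S] (φ : R →ₐ[ℝ] S) (a b : ℕ → ℝ)
    (A B : R) (q k : ℕ) :
    coeff k (formalProd a b (φ A) (φ B) q) = φ (coeff k (formalProd a b A B q)) := by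
  rw [← map_formalProd, PowerSeries.coeff_map, RingHom.coe_coe]

variable {M E V : Type*} [TopologicalSpace E] [NormedRing V] [NormedAlgebra ℝ V]
  [AddCommGroup M] [Module ℝ M]

/-- Operators on functions compose from right to left, so that multiplying a formal series of
operators on the right by `exp(αXx)` in the opposite algebra is to apply `exp(αXx)` last. -/
theorem HasExpansion.mul_formalExp {N : ℕ} {ev : M →ₗ[ℝ] (E → V)} {ψ : ℝ → E → V} {m₀ : M}
    {P : PowerSeries (Module.End ℝ M)ᵐᵒᵖ}
    (h : HasExpansion N ev ψ fun k => (unop (coeff k P)) m₀)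
    {X : Module.End ℝ M} {π : ℝ → E → E} {w : ℝ → E → V} (hX : IsFlow ev X π w) (α : ℝ) :
    HasExpansion N ev (fun x p => ψ x (π (α * x) p) * w (α * x) p)
      fun k => (unop (coeff k (P * formalExp α (op X)))) m₀ := by
  refine h.flow hX α fun k => ?_
  rw [coeff_mul, Finset.Nat.sum_antidiagonal_eq_sum_range_succ_mk]
  simp only [coeff_formalExp, ← op_pow, ← op_smul]
  simp [LinearMap.sum_apply]

/-- The operator product `e^{a_{q+1}xA} e^{b_q xB} ⋯ e^{b₁xB} e^{a₁xA}` of two flows, applied to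
the function `ψ`. -/
def composeFlows (a b : ℕ → ℝ) (πA : ℝ → E → E) (wA : ℝ → E → V) (πB : ℝ → E → E)
    (wB : ℝ → E → V) (ψ : E → V) : ℕ → ℝ → E → V
  | 0, x, p => ψ (πA (a 1 * x) p) * wA (a 1 * x) p
  | q + 1, x, p =>
    composeFlows a b πA wA πB wB ψ q x (πB (b (q + 1) * x) (πA (a (q + 2) * x) p)) *
      wB (b (q + 1) * x) (πA (a (q + 2) * x) p) * wA (a (q + 2) * x) p

theorem hasExpansion_composeFlows (N : ℕ) {ev : M →ₗ[ℝ] (E → V)} (m₀ : M)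
    (hm : ∀ p₀, (fun z : ℝ × E => ev m₀ z.2) =O[𝓝 (0, p₀)] fun _ => (1 : ℝ))
    {A B : Module.End ℝ M} {πA πB : ℝ → E → E} {wA wB : ℝ → E → V}
    (hA : IsFlow ev A πA wA) (hB : IsFlow ev B πB wB) (a b : ℕ → ℝ) (q : ℕ) :
    HasExpansion N ev (composeFlows a b πA wA πB wB (ev m₀) q)
      fun k => (unop (coeff k (formalProd a b (op A) (op B) q))) m₀ := by
  induction q with
  | zero =>
    have h1 : HasExpansion N ev (fun _ p => ev m₀ p)
        fun k => (unop (coeff k (1 : PowerSeries (Module.End ℝ M)ᵐᵒᵖ))) m₀ := by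
      convert hasExpansion_const ev m₀ hm using 2 with k
      rw [coeff_one]
      split_ifs <;> simp
    have h2 := h1.mul_formalExp hA (a 1)
    rw [one_mul] at h2
    exact h2
  | succ q ih => exact (ih.mul_formalExp hB (b (q + 1))).mul_formalExp hA (a (q + 2))

end FormalProduct

/-- The coefficients of an asymptotic expansion are unique. -/
theorem eq_zero_of_sum_pow_smul_isBigO {V : Type*} [NormedAddCommGroup V] [NormedSpace ℝ V]
    (N : ℕ) (C : ℕ → V)
    (h : (fun x : ℝ => ∑ k ∈ Finset.range N, x ^ k • C k) =O[𝓝[≠] 0] fun x => x ^ N) :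
    ∀ k < N, C k = 0 := by
  induction N generalizing C with
  | zero => simp
  | succ N ih =>
    have h0 : C 0 = 0 := by
      have h1 : Tendsto (fun x : ℝ => ∑ k ∈ Finset.range (N + 1), x ^ k • C k) (𝓝[≠] 0)
          (𝓝 (C 0)) := by
        have hc : Continuous (fun x : ℝ => ∑ k ∈ Finset.range (N + 1), x ^ k • C k) := by fun_prop
        have := hc.tendsto 0
        rw [Finset.sum_range_succ'] at this
        simp only [pow_succ, mul_zero, zero_smul, Finset.sum_const_zero, pow_zero, one_smul,
          zero_add] at this
        exact this.mono_left nhdsWithin_le_nhds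
      have h2 : Tendsto (fun x : ℝ => x ^ (N + 1)) (𝓝[≠] 0) (𝓝 0) := by
        have hc : Continuous (fun x : ℝ => x ^ (N + 1)) := by fun_prop
        exact (hc.tendsto' 0 0 (by simp)).mono_left nhdsWithin_le_nhds
      exact tendsto_nhds_unique h1 (h.trans_tendsto h2)
    have h1 : (fun x : ℝ => ∑ k ∈ Finset.range N, x ^ k • C (k + 1)) =O[𝓝[≠] 0]
        fun x => x ^ N := by
      have h2 := (isBigO_refl (fun x : ℝ => x⁻¹) (𝓝[≠] 0)).smul h
      refine h2.congr' ?_ ?_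
      · filter_upwards [self_mem_nhdsWithin] with x hx
        have hx' : x ≠ 0 := hx
        rw [Finset.sum_range_succ', h0, smul_zero, add_zero, Finset.smul_sum]
        refine Finset.sum_congr rfl fun k _ => ?_
        rw [smul_smul, pow_succ]
        congr 1
        field_simp
      · filter_upwards [self_mem_nhdsWithin] with x hx
        have hx' : x ≠ 0 := hx
        rw [smul_eq_mul, pow_succ]
        field_simp
    intro k hk
    cases k with
    | zero => exact h0
    | succ k => exact ih _ h1 k (by omega)

/-! ### Order conditions as identities in every algebra -/

section OrderConditions

open MulOpposite PowerSeries

section Matrices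

variable {𝔸 : Type*} [NormedRing 𝔸] [NormedAlgebra ℝ 𝔸] [CompleteSpace 𝔸]

theorem isBigO_one_mul_exp_smul (f X : 𝔸) (p₀ : Unit) :
    (fun z : ℝ × Unit => f * NormedSpace.exp (z.1 • X)) =O[𝓝 (0, p₀)] fun _ => (1 : ℝ) := by
  have hc : ContinuousAt (fun z : ℝ × Unit => f * NormedSpace.exp (z.1 • X)) (0, p₀) := by
    have : Continuous fun x : ℝ => NormedSpace.exp (x • X) :=
      continuous_iff_continuousAt.2 fun x => (hasDerivAt_exp_smul_const X x).continuousAt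
    exact ((this.comp continuous_fst).const_mul f).continuousAt
  exact hc.tendsto.isBigO_one ℝ

/-- Right multiplication by `exp(xX)` is a flow on an algebra regarded as the functions on a
point. -/
theorem isFlow_mulRight_exp (X : 𝔸) :
    IsFlow (E := Unit) (LinearMap.pi fun _ => LinearMap.id) (LinearMap.mulRight ℝ X)
      (fun _ p => p) (fun x _ => NormedSpace.exp (x • X)) where
  continuousAt p := continuous_snd.continuousAt
  map_zero p := rfl
  isBigO_one p₀ := by simpa using isBigO_one_mul_exp_smul 1 X p₀
  taylor N f p₀ := by
    have := isBigO_flow_sub_taylor (E := Unit) (fun f : 𝔸 => f * X) (fun f _ => f)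
      (fun f x _ => f * NormedSpace.exp (x • X)) (by simp)
      (fun f x _ => by
        simpa [mul_assoc] using (hasDerivAt_exp_smul_const' X x).const_mul f)
      (fun f p₀ => isBigO_one_mul_exp_smul f X p₀) N f p₀
    refine this.congr_left fun z => ?_
    simp only [LinearMap.pi_apply, LinearMap.id_apply, Module.End.pow_apply]
    rfl

end Matrices

/-- The generator `c` of the free monoid on two letters acts on `ℂ^{|u|+1}` as a partial shift: it
sends the basis vector `e_{i+1}` to `e_i` if `c` is the `i`-th letter of the word `u`, and all
other basis vectors to `0`. -/
noncomputable def wordShift (u : List Bool) (c : Bool) :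
    EuclideanSpace ℂ (Fin (u.length + 1)) →L[ℂ] EuclideanSpace ℂ (Fin (u.length + 1)) :=
  LinearMap.toContinuousLinearMap
    { toFun := fun ψ => WithLp.toLp 2 fun i =>
        if h : i.1 < u.length then
          if u[i.1] = c then ψ ⟨i.1 + 1, by omega⟩ else 0
        else 0
      map_add' := fun ψ φ => by
        ext i
        simp only [PiLp.add_apply]
        split_ifs <;> simp
      map_smul' := fun r ψ => by
        ext i
        simp only [PiLp.smul_apply]
        split_ifs <;> simp }

theorem wordShift_apply (u : List Bool) (c : Bool) (ψ : EuclideanSpace ℂ (Fin (u.length + 1)))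
    (i : Fin (u.length + 1)) :
    wordShift u c ψ i = if h : i.1 < u.length then
          if u[i.1] = c then ψ ⟨i.1 + 1, by omega⟩ else 0
        else 0 := rfl

/-- The matrix entry that reads off the word `u`: acting with the letters of a word `v` on the last
basis vector gives the first basis vector exactly when `v = u`. -/
theorem lift_wordShift_apply (u : List Bool) (v : FreeMonoid Bool) (i : Fin (u.length + 1)) :
    FreeMonoid.lift (wordShift u) v (EuclideanSpace.single (Fin.last _) 1) i =
      if v.toList = u.drop i then 1 else 0 := by
  induction v using FreeMonoid.inductionOn' generalizing i with
  | one =>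
    rw [map_one, one_apply_eq_self, PiLp.single_apply]
    have : i = Fin.last u.length ↔ FreeMonoid.toList (1 : FreeMonoid Bool) = u.drop i := by
      rw [FreeMonoid.toList_one, eq_comm (a := []), List.drop_eq_nil_iff, Fin.ext_iff, Fin.val_last]
      omega
    simp only [this]
  | of_mul c v ih =>
    rw [map_mul, mul_apply_eq_comp, FreeMonoid.lift_eval_of, wordShift_apply]
    by_cases h : i.1 < u.length
    · rw [dif_pos h, ih, List.drop_eq_getElem_cons h, FreeMonoid.toList_of_mul]
      simp only [List.cons.injEq]
      by_cases hc : u[i.1] = c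
      · simp [hc]
      · simp [hc, Ne.symm hc]
    · rw [dif_neg h, List.drop_eq_nil_of_le (by omega), FreeMonoid.toList_of_mul]
      simp

theorem forwardProd_succ_right {M : Type*} [Monoid M] (q : ℕ) (f : ℕ → M) :
    forwardProd 1 (q + 1) f = forwardProd 1 q f * f (q + 1) := by
  simp [forwardProd, List.range'_concat, add_comm]

theorem composeFlows_exp {m : ℕ} (a b : ℕ → ℝ)
    (A B : EuclideanSpace ℂ (Fin m) →L[ℂ] EuclideanSpace ℂ (Fin m)) (q : ℕ) (x : ℝ) (p : Unit) :
    composeFlows a b (fun _ p => p) (fun x _ => NormedSpace.exp (x • A)) (fun _ p => p)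
        (fun x _ => NormedSpace.exp (x • B)) (fun _ => 1) q x p =
      forwardProd 1 q (fun j => NormedSpace.exp (((a j * x : ℝ) : ℂ) • A) *
            NormedSpace.exp (((b j * x : ℝ) : ℂ) • B)) *
          NormedSpace.exp (((a (q + 1) * x : ℝ) : ℂ) • A) := by
  have hsmul : ∀ (r : ℝ) (X : EuclideanSpace ℂ (Fin m) →L[ℂ] EuclideanSpace ℂ (Fin m)),
      (r : ℂ) • X = r • X := fun r X => rfl
  simp only [hsmul]
  induction q with
  | zero => simp [composeFlows, forwardProd]
  | succ q ih => simp only [composeFlows, ih, forwardProd_succ_right, mul_assoc]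

/-- The order conditions in matrix algebras, in terms of formal power series. -/
theorem IsProductFormulaOfOrder.matrix_coeff {n q : ℕ} {a b : ℕ → ℝ}
    (hab : IsProductFormulaOfOrder n q a b) {m : ℕ}
    (A B : EuclideanSpace ℂ (Fin m) →L[ℂ] EuclideanSpace ℂ (Fin m)) {k : ℕ} (hk : k ≤ n) :
    unop (coeff k (formalProd a b (op (LinearMap.mulRight ℝ A)) (op (LinearMap.mulRight ℝ B)) q))
        1 =
      unop (coeff k (formalExp 1 (op (LinearMap.mulRight ℝ A) + op (LinearMap.mulRight ℝ B))))
        1 := by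
  have hone : ∀ p₀ : Unit, (fun z : ℝ × Unit =>
      (LinearMap.pi fun _ : Unit => LinearMap.id (R := ℝ))
        (1 : EuclideanSpace ℂ (Fin m) →L[ℂ] EuclideanSpace ℂ (Fin m)) z.2)
      =O[𝓝 (0, p₀)] fun _ => (1 : ℝ) := fun p₀ => isBigO_const_const _ one_ne_zero _
  have h1 := hasExpansion_composeFlows (n + 1) _ hone (isFlow_mulRight_exp A)
    (isFlow_mulRight_exp B) a b q
  have h2 := (isFlow_mulRight_exp (A + B)).taylor (n + 1) 1 ()
  have h3 := h1 ()
  have ht : Tendsto (fun x : ℝ => (x, ())) (𝓝 0) (𝓝 (0, ())) := by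
    have : Continuous (fun x : ℝ => (x, ())) := by fun_prop
    exact this.tendsto 0
  have h4 := hab m A B
  have h5 := ((h2.sub h3).comp_tendsto ht).add (h4.neg_left.congr_right fun _ => rfl)
  have h6 := eq_zero_of_sum_pow_smul_isBigO (n + 1) (fun k =>
    unop (coeff k (formalProd a b (op (LinearMap.mulRight ℝ A)) (op (LinearMap.mulRight ℝ B)) q))
        (1 : EuclideanSpace ℂ (Fin m) →L[ℂ] EuclideanSpace ℂ (Fin m)) -
      unop (coeff k (formalExp 1 (op (LinearMap.mulRight ℝ A) + op (LinearMap.mulRight ℝ B))))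
        1) ((h5.mono nhdsWithin_le_nhds).congr_left fun x => ?_) k (by omega)
  · exact sub_eq_zero.1 h6
  have h7 := composeFlows_exp a b A B q x ()
  have h8 : ∀ k, unop (coeff k (formalExp 1 (op (LinearMap.mulRight ℝ A) +
      op (LinearMap.mulRight ℝ B)))) 1 =
        (1 / (k.factorial : ℝ)) • (LinearMap.mulRight ℝ (A + B) ^ k)
        (1 : EuclideanSpace ℂ (Fin m) →L[ℂ] EuclideanSpace ℂ (Fin m)) := by
    intro k
    have : LinearMap.mulRight ℝ (A + B) = LinearMap.mulRight ℝ A + LinearMap.mulRight ℝ B := by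
      ext; simp [mul_add]
    rw [coeff_formalExp, one_pow, ← op_add, ← op_pow, ← op_smul, unop_op,
      LinearMap.smul_apply, this]
  have h9 : NormedSpace.exp ((x : ℂ) • (A + B)) = NormedSpace.exp (x • (A + B)) := rfl
  have h10 : ((LinearMap.pi fun _ : Unit => LinearMap.id (R := ℝ))
        (1 : EuclideanSpace ℂ (Fin m) →L[ℂ] EuclideanSpace ℂ (Fin m))) = fun _ => 1 := rfl
  simp only [Function.comp, ← h7, h8, h9, h10, one_mul, smul_sub, Finset.sum_sub_distrib,
    smul_smul, mul_one_div, LinearMap.pi_apply, LinearMap.id_apply]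
  abel

/-- The matrix algebra of `wordShift u`, acting on itself from the right, as a representation of the
monoid algebra of words in two letters. -/
noncomputable def wordRep (u : List Bool) : MonoidAlgebra ℝ (FreeMonoid Bool) →ₐ[ℝ]
    (Module.End ℝ (EuclideanSpace ℂ (Fin (u.length + 1)) →L[ℂ]
      EuclideanSpace ℂ (Fin (u.length + 1))))ᵐᵒᵖ :=
  MonoidAlgebra.lift ℝ _ _ (FreeMonoid.lift fun c => op (LinearMap.mulRight ℝ (wordShift u c)))

theorem wordRep_single_of (u : List Bool) (c : Bool) :
    wordRep u (MonoidAlgebra.single (FreeMonoid.of c) 1) =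
      op (LinearMap.mulRight ℝ (wordShift u c)) := by
  simp [wordRep, MonoidAlgebra.lift_single]

theorem wordRep_single (u : List Bool) (v : FreeMonoid Bool) :
    unop (wordRep u (MonoidAlgebra.single v 1)) 1 = FreeMonoid.lift (wordShift u) v := by
  have h1 : ∀ T, unop (wordRep u (MonoidAlgebra.single v 1)) T =
      T * FreeMonoid.lift (wordShift u) v := by
    simp only [wordRep, MonoidAlgebra.lift_single, one_smul]
    induction v using FreeMonoid.inductionOn' with
    | one => simp
    | of_mul c v ih =>
      intro T
      rw [map_mul, unop_mul, Module.End.mul_apply, ih, map_mul, FreeMonoid.lift_eval_of,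
        FreeMonoid.lift_eval_of, unop_op, LinearMap.mulRight_apply, mul_assoc]
  rw [h1, one_mul]

theorem wordRep_apply (u : FreeMonoid Bool) (r : MonoidAlgebra ℝ (FreeMonoid Bool)) :
    unop (wordRep u.toList r) 1 (EuclideanSpace.single (Fin.last _) 1) 0 = (r.coeff u : ℂ) := by
  induction r using MonoidAlgebra.induction_linear with
  | zero => simp
  | add r s hr hs =>
    rw [map_add, unop_add, LinearMap.add_apply, add_apply, PiLp.add_apply, hr, hs]
    simp
  | single v y =>
    have h1 : (MonoidAlgebra.single v y : MonoidAlgebra ℝ (FreeMonoid Bool)) =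
      y • MonoidAlgebra.single v 1 := by simp
    have h2 := lift_wordShift_apply u.toList v 0
    rw [h1, map_smul, unop_smul, LinearMap.smul_apply, wordRep_single]
    refine (congrArg (fun z : ℂ => (y : ℂ) * z) h2).trans ?_
    classical
    have h3 : v.toList = u.toList.drop 0 ↔ v = u := by simp
    simp only [Fin.val_zero, h3, MonoidAlgebra.coeff_smul, Finsupp.smul_apply,
      MonoidAlgebra.coeff_single, Finsupp.single_apply]
    split_ifs <;> simp

/-- The order conditions hold in every algebra: they are identities between polynomials in two
non-commuting variables, and the coefficient of each word is an entry of a suitable matrix. -/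
theorem IsProductFormulaOfOrder.coeff_formalProd {n q : ℕ} {a b : ℕ → ℝ}
    (hab : IsProductFormulaOfOrder n q a b) {R : Type*} [Semiring R] [Algebra ℝ R] (A B : R) {k : ℕ}
    (hk : k ≤ n) :
    coeff k (formalProd a b A B q) = coeff k (formalExp 1 (A + B)) := by
  let x : Bool → MonoidAlgebra ℝ (FreeMonoid Bool) := fun c =>
    MonoidAlgebra.single (FreeMonoid.of c) 1
  -- It is enough to consider the free algebra on two generators, which maps to `R`.
  suffices h : coeff k (formalProd a b (x true) (x false) q) =
      coeff k (formalExp 1 (x true + x false)) by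
    let φ : MonoidAlgebra ℝ (FreeMonoid Bool) →ₐ[ℝ] R :=
      MonoidAlgebra.lift ℝ R _ (FreeMonoid.lift fun c => if c then A else B)
    have h1 : φ (x true) = A := by simp [φ, x, MonoidAlgebra.lift_single]
    have h2 : φ (x false) = B := by simp [φ, x, MonoidAlgebra.lift_single]
    have h3 := congrArg φ h
    rwa [← coeff_formalProd_map, ← coeff_formalExp_map, map_add, h1, h2] at h3
  ext u
  have h1 := hab.matrix_coeff (wordShift u.toList true) (wordShift u.toList false) hk
  have e0 : wordRep u.toList (x true + x false) = op (LinearMap.mulRight ℝ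
      (wordShift u.toList true)) + op (LinearMap.mulRight ℝ (wordShift u.toList false)) :=
    (map_add _ _ _).trans (congrArg₂ (· + ·) (wordRep_single_of _ _) (wordRep_single_of _ _))
  have e1 := coeff_formalProd_map (wordRep u.toList) a b (x true) (x false) q k
  rw [wordRep_single_of, wordRep_single_of] at e1
  have e2 := (congrArg (fun X => coeff k (formalExp 1 X)) e0).symm.trans
    (coeff_formalExp_map (wordRep u.toList) 1 (x true + x false) k)
  rw [e1, e2] at h1
  have h2 := congrArg (fun T => T (EuclideanSpace.single (Fin.last _) 1) 0) h1
  simp only [wordRep_apply] at h2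
  exact_mod_cast h2

end OrderConditions

/-! ### The Dyson series -/

section Dyson

variable {𝓗 : Type*} [NormedAddCommGroup 𝓗] [InnerProductSpace ℂ 𝓗]

theorem hasDerivAt_dysonTerm_succ [CompleteSpace 𝓗] {H : ℝ → 𝓗 →L[ℂ] 𝓗} (hH : Continuous H)
    (s : ℝ) (j : ℕ) (hj : Continuous (dysonTerm H s j)) (t : ℝ) :
    HasDerivAt (dysonTerm H s (j + 1)) ((-Complex.I) • (H t * dysonTerm H s j t)) t := by
  have hc : Continuous fun r => (-Complex.I) • (H r * dysonTerm H s j r) := by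
    have : Continuous fun r => H r * dysonTerm H s j r := by fun_prop
    exact this.const_smul (-Complex.I)
  exact (hc.integral_hasStrictDerivAt s t).hasDerivAt

theorem continuous_dysonTerm [CompleteSpace 𝓗] {H : ℝ → 𝓗 →L[ℂ] 𝓗} (hH : Continuous H) (s : ℝ)
    (j : ℕ) : Continuous (dysonTerm H s j) := by
  induction j with
  | zero => exact continuous_const
  | succ j ih =>
    exact continuous_iff_continuousAt.2 fun t =>
      (hasDerivAt_dysonTerm_succ hH s j ih t).continuousAt

theorem norm_dysonTerm_le {H : ℝ → 𝓗 →L[ℂ] 𝓗} {s C : ℝ} (hC : 0 ≤ C) (j : ℕ) {t : ℝ}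
    (hb : ∀ r ∈ Set.uIcc s t, ‖H r‖ ≤ C) :
    ‖dysonTerm H s j t‖ ≤ (C * |t - s|) ^ j / j.factorial := by
  induction j generalizing t with
  | zero =>
    rw [pow_zero, Nat.factorial_zero, Nat.cast_one, div_one]
    exact ContinuousLinearMap.norm_id_le (𝕜 := ℂ) (E := 𝓗)
  | succ j ih =>
    have h1 : ∀ r ∈ Set.uIoc s t, ‖(-Complex.I) • (H r * dysonTerm H s j r)‖ ≤
        C ^ (j + 1) / j.factorial * |r - s| ^ j := by
      intro r hr
      have hr' := Set.uIoc_subset_uIcc hr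
      rw [norm_smul, norm_neg, Complex.norm_I, one_mul]
      refine (norm_mul_le _ _).trans ((mul_le_mul (hb r hr') (ih fun r' h' => hb r'
        (Set.uIcc_subset_uIcc_left hr' h')) (norm_nonneg _) hC).trans_eq ?_)
      rw [mul_pow, pow_succ]
      ring
    refine intervalIntegral.norm_integral_le_integral_norm_uIoc.trans ?_
    refine (MeasureTheory.integral_mono_of_nonneg
      (MeasureTheory.ae_of_all _ fun _ => norm_nonneg _) ?_
      (MeasureTheory.ae_restrict_of_forall_mem measurableSet_uIoc h1)).trans_eq ?_
    · have hc : Continuous fun r : ℝ => C ^ (j + 1) / j.factorial * |r - s| ^ j := by fun_prop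
      exact (hc.integrableOn_uIcc (a := s) (b := t)).mono_set Set.uIoc_subset_uIcc
    · rw [MeasureTheory.integral_const_mul, integral_pow_abs_sub_uIoc, Nat.factorial_succ, mul_pow]
      push_cast
      field_simp

theorem exists_norm_le_on_Icc {H : ℝ → 𝓗 →L[ℂ] 𝓗} (hH : Continuous H) (x y : ℝ) :
    ∃ C, 0 ≤ C ∧ ∀ r ∈ Set.Icc x y, ‖H r‖ ≤ C := by
  obtain ⟨C, hC⟩ := isCompact_Icc.exists_bound_of_continuousOn (hH.continuousOn (s := Set.Icc x y))
  exact ⟨max C 0, le_max_right _ _, fun r hr => (hC r hr).trans (le_max_left _ _)⟩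

@[simp]
theorem timeOrderedExp_self (H : ℝ → 𝓗 →L[ℂ] 𝓗) (s : ℝ) : timeOrderedExp H s s = 1 := by
  rw [timeOrderedExp, tsum_eq_single 0]
  · rfl
  · intro j hj
    obtain ⟨j, rfl⟩ := Nat.exists_eq_succ_of_ne_zero hj
    simp [dysonTerm]

theorem norm_timeOrderedExp_le {H : ℝ → 𝓗 →L[ℂ] 𝓗} {s t C : ℝ} (hC : 0 ≤ C)
    (hb : ∀ r ∈ Set.uIcc s t, ‖H r‖ ≤ C) :
    ‖timeOrderedExp H t s‖ ≤ Real.exp (C * |t - s|) := by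
  have hs := Real.summable_pow_div_factorial (C * |t - s|)
  refine (tsum_of_norm_bounded hs.hasSum fun j => norm_dysonTerm_le hC j hb).trans_eq ?_
  rw [Real.exp_eq_exp_ℝ, NormedSpace.exp_eq_tsum_div]

theorem hasDerivAt_timeOrderedExp [CompleteSpace 𝓗] {H : ℝ → 𝓗 →L[ℂ] 𝓗} (hH : Continuous H)
    (s t : ℝ) :
    HasDerivAt (fun t => timeOrderedExp H t s) (((-Complex.I) • H t) * timeOrderedExp H t s) t := by
  -- Bounds that are uniform on a ball containing both times allow termwise differentiation.
  set ρ := |t - s| + 1 with hρ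
  have hρ0 : 0 < ρ := by positivity
  obtain ⟨C, hC, hCb⟩ := exists_norm_le_on_Icc hH (s - ρ) (s + ρ)
  have hball : ∀ y ∈ Metric.ball s ρ, |y - s| ≤ ρ := fun y hy => by
    simpa [Real.dist_eq] using (Metric.mem_ball.1 hy).le
  have hbd : ∀ y ∈ Metric.ball s ρ, ∀ r ∈ Set.uIcc s y, ‖H r‖ ≤ C := by
    intro y hy r hr
    refine hCb r ?_
    have h1 := Set.abs_sub_left_of_mem_uIcc hr
    have h2 := hball y hy
    have h3 := abs_le.1 (h1.trans h2)
    exact ⟨by linarith, by linarith⟩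
  have ht : t ∈ Metric.ball s ρ := by
    rw [Metric.mem_ball, Real.dist_eq]
    linarith
  have hterm : ∀ y ∈ Metric.ball s ρ, ∀ j,
      ‖dysonTerm H s j y‖ ≤ (C * ρ) ^ j / j.factorial := fun y hy j =>
    (norm_dysonTerm_le hC j (hbd y hy)).trans (by have := hball y hy; gcongr)
  have hsum : Summable fun j => (C * ρ) ^ j / (j.factorial : ℝ) :=
    Real.summable_pow_div_factorial _
  have hDsum : Summable fun j => dysonTerm H s j t :=
    Summable.of_norm_bounded hsum (hterm t ht)
  let g' : ℕ → ℝ → 𝓗 →L[ℂ] 𝓗 := fun j y =>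
    match j with
    | 0 => 0
    | j + 1 => (-Complex.I) • (H y * dysonTerm H s j y)
  let u : ℕ → ℝ := fun j =>
    match j with
    | 0 => 0
    | j + 1 => C * ((C * ρ) ^ j / (j.factorial : ℝ))
  have hu : Summable u := (summable_nat_add_iff 1).1 (hsum.mul_left C)
  have hg : ∀ (j : ℕ) (y : ℝ), y ∈ Metric.ball s ρ → HasDerivAt (dysonTerm H s j) (g' j y) y := by
    intro j y _
    cases j with
    | zero => exact hasDerivAt_const _ _
    | succ j => exact hasDerivAt_dysonTerm_succ hH s j (continuous_dysonTerm hH s j) y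
  have hg' : ∀ (j : ℕ) (y : ℝ), y ∈ Metric.ball s ρ → ‖g' j y‖ ≤ u j := by
    intro j y hy
    cases j with
    | zero => simp [g', u]
    | succ j =>
      simp only [g', u]
      rw [norm_smul, norm_neg, Complex.norm_I, one_mul]
      exact (norm_mul_le _ _).trans (mul_le_mul (hbd y hy y Set.right_mem_uIcc) (hterm y hy j)
        (norm_nonneg _) hC)
  have key := hasDerivAt_tsum_of_isPreconnected hu Metric.isOpen_ball
    (convex_ball s ρ).isPreconnected hg hg' ht hDsum ht
  refine key.congr_deriv ?_
  have hgs : Summable fun j => g' j t := Summable.of_norm_bounded hu fun j => hg' j t ht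
  rw [hgs.tsum_eq_zero_add]
  simp only [g', zero_add]
  rw [timeOrderedExp, smul_mul_assoc, ← hDsum.tsum_mul_left, tsum_const_smul'']

theorem isBigO_one_timeOrderedExp {H : ℝ → 𝓗 →L[ℂ] 𝓗} (hH : Continuous H) (t₀ : ℝ) :
    (fun z : ℝ × ℝ => timeOrderedExp H (z.2 + z.1) z.2) =O[𝓝 (0, t₀)] fun _ => (1 : ℝ) := by
  obtain ⟨C, hC, hCb⟩ := exists_norm_le_on_Icc hH (t₀ - 2) (t₀ + 2)
  refine IsBigO.of_bound (Real.exp C) ?_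
  filter_upwards [Metric.ball_mem_nhds ((0 : ℝ), t₀) one_pos] with z hz
  rw [Metric.mem_ball, Prod.dist_eq, max_lt_iff, Real.dist_eq, Real.dist_eq, sub_zero] at hz
  have h1 := abs_lt.1 hz.1
  have h2 := abs_lt.1 hz.2
  rw [norm_one, mul_one]
  refine (norm_timeOrderedExp_le hC fun r hr => hCb r ?_).trans ?_
  · have h3 := abs_le.1 (Set.abs_sub_left_of_mem_uIcc hr)
    rw [add_sub_cancel_left] at h3
    exact ⟨by linarith [h3.1], by linarith [h3.2]⟩
  · rw [add_sub_cancel_left]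
    exact Real.exp_le_exp.2 (mul_le_of_le_one_right hC hz.1.le)

theorem hasDerivAt_evolve [CompleteSpace 𝓗] (A : 𝓗 →L[ℂ] 𝓗) (t : ℝ) :
    HasDerivAt (evolve A) (((-Complex.I) • A) * evolve A t) t := by
  have h := hasDerivAt_exp_smul_const' ((-Complex.I) • A) t
  have he : ∀ τ : ℝ, NormedSpace.exp (τ • (-Complex.I) • A) = evolve A τ := by
    intro τ
    rw [evolve, ← Complex.coe_smul, smul_smul]
    congr 2
    ring
  simp only [he] at h
  exact h

@[simp]
theorem evolve_zero (A : 𝓗 →L[ℂ] 𝓗) : evolve A 0 = 1 := by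
  simp [evolve]

theorem evolve_add [CompleteSpace 𝓗] (A : 𝓗 →L[ℂ] 𝓗) (σ τ : ℝ) :
    evolve A (σ + τ) = evolve A σ * evolve A τ := by
  -- The addition law of `NormedSpace.exp` is stated for normed `ℚ`-algebras.
  let : NormedAlgebra ℚ (𝓗 →L[ℂ] 𝓗) := NormedAlgebra.restrictScalars ℚ ℂ _
  rw [evolve, evolve, evolve, ← NormedSpace.exp_add_of_commute]
  · rw [← add_smul]
    congr 2
    push_cast
    ring
  · exact ((Commute.refl A).smul_left _).smul_right _

theorem evolve_mul_evolve_neg [CompleteSpace 𝓗] (A : 𝓗 →L[ℂ] 𝓗) {σ τ : ℝ} (h : σ + τ = 0) :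
    evolve A σ * evolve A τ = 1 := by
  rw [← evolve_add, h, evolve_zero]

/-- For a constant Hamiltonian the time-ordered exponential is the exponential. -/
theorem timeOrderedExp_const [CompleteSpace 𝓗] (A : 𝓗 →L[ℂ] 𝓗) (t s : ℝ) :
    timeOrderedExp (fun _ => A) t s = evolve A (t - s) := by
  have hd : ∀ t, HasDerivAt (fun t => evolve A (s - t) * timeOrderedExp (fun _ => A) t s) 0 t := by
    intro t
    have h1 := (hasDerivAt_evolve A (s - t)).scomp t ((hasDerivAt_id t).const_sub s)
    have h2 := h1.mul (hasDerivAt_timeOrderedExp (H := fun _ => A) continuous_const s t)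
    refine h2.congr_deriv ?_
    have hcomm : Commute ((-Complex.I) • A) (evolve A (s - t)) := by
      let : NormedAlgebra ℚ (𝓗 →L[ℂ] 𝓗) := NormedAlgebra.restrictScalars ℚ ℂ _
      exact (((Commute.refl A).smul_left _).smul_right _).exp_right
    simp only [Function.comp, neg_smul, one_smul] at hcomm ⊢
    rw [hcomm.eq, neg_mul, mul_assoc, neg_add_cancel]
  have h1 := is_const_of_deriv_eq_zero (fun t => (hd t).differentiableAt)
    (fun t => (hd t).deriv) t s
  simp only [sub_self, evolve_zero, timeOrderedExp_self, one_mul] at h1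
  rw [← one_mul (timeOrderedExp _ t s),
    ← evolve_mul_evolve_neg A (σ := t - s) (τ := s - t) (by ring), mul_assoc, h1, mul_one]

end Dyson

/-! ### Smooth maps of two times -/

section SmoothMaps

variable {𝔸 : Type*} [NormedRing 𝔸] [NormedAlgebra ℝ 𝔸]

variable (𝔸) in
/-- The smooth maps from the plane of pairs of times `(u, v)` to an algebra. -/
def smoothMaps : Submodule ℝ (ℝ × ℝ → 𝔸) where
  carrier := {f | ContDiff ℝ ∞ f}
  zero_mem' := by
    change ContDiff ℝ ∞ fun _ => (0 : 𝔸)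
    exact contDiff_const
  add_mem' {f g} hf hg := by
    change ContDiff ℝ ∞ f at hf
    change ContDiff ℝ ∞ g at hg
    exact hf.add hg
  smul_mem' c f hf := by
    change ContDiff ℝ ∞ f at hf
    exact hf.const_smul c

theorem contDiff_smoothMaps (f : smoothMaps 𝔸) : ContDiff ℝ ∞ f.1 := f.2

theorem differentiableAt_smoothMaps (f : smoothMaps 𝔸) (p : ℝ × ℝ) : DifferentiableAt ℝ f.1 p :=
  ((contDiff_smoothMaps f).differentiable (by simp)).differentiableAt

/-- The operator `f ↦ ∂_e (f F) G` of smooth maps, to be used with `G = F⁻¹`: the directional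
derivative `∂_e`, conjugated by right multiplication by `F`. -/
noncomputable def twistedDeriv (F G : smoothMaps 𝔸) (e : ℝ × ℝ) :
    Module.End ℝ (smoothMaps 𝔸) where
  toFun f := ⟨fun p => fderiv ℝ (fun r => f.1 r * F.1 r) p e * G.1 p,
    ((((contDiff_smoothMaps f).mul (contDiff_smoothMaps F)).fderiv_right (m := ∞)
      (by simp)).clm_apply contDiff_const).mul (contDiff_smoothMaps G)⟩
  map_add' f g := by
    ext p
    have h1 : ∀ f : smoothMaps 𝔸, DifferentiableAt ℝ (fun r => f.1 r * F.1 r) p := fun f =>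
      (differentiableAt_smoothMaps f p).mul (differentiableAt_smoothMaps F p)
    have h2 := fderiv_fun_add (h1 f) (h1 g)
    simp only [Submodule.coe_add, Pi.add_apply, add_mul, h2, add_apply]
  map_smul' c f := by
    ext p
    have h1 : DifferentiableAt ℝ (fun r => f.1 r * F.1 r) p :=
      (differentiableAt_smoothMaps f p).mul (differentiableAt_smoothMaps F p)
    have h2 := fderiv_fun_const_smul h1 c
    simp only [Submodule.coe_smul, Pi.smul_apply, smul_mul_assoc, h2, smul_apply, RingHom.id_apply]

theorem twistedDeriv_apply (F G : smoothMaps 𝔸) (e : ℝ × ℝ) (f : smoothMaps 𝔸) (p : ℝ × ℝ) :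
    (twistedDeriv F G e f).1 p = fderiv ℝ (fun r => f.1 r * F.1 r) p e * G.1 p := rfl

theorem isFlow_twistedDeriv {F G : smoothMaps 𝔸} (hFG : ∀ p, F.1 p * G.1 p = 1)
    (hGF : ∀ p, G.1 p * F.1 p = 1) (e : ℝ × ℝ) :
    IsFlow (smoothMaps 𝔸).subtype (twistedDeriv F G e) (fun x p => p + x • e)
      (fun x p => F.1 (p + x • e) * G.1 p) := by
  have hF := (contDiff_smoothMaps F).continuous
  have hG := (contDiff_smoothMaps G).continuous
  refine ⟨fun p => ?_, fun p => by simp, fun p₀ => ?_, fun N f p₀ => ?_⟩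
  · have : Continuous fun z : ℝ × (ℝ × ℝ) => z.2 + z.1 • e := by fun_prop
    exact this.continuousAt
  · have : Continuous fun z : ℝ × (ℝ × ℝ) => F.1 (z.2 + z.1 • e) * G.1 z.2 := by fun_prop
    exact this.continuousAt.tendsto.isBigO_one ℝ
  · have key := isBigO_flow_sub_taylor (twistedDeriv F G e) (fun f p => f.1 p)
      (fun f x p => f.1 (p + x • e) * (F.1 (p + x • e) * G.1 p)) (fun f p => by simp [hFG])
      (fun f x p => ?_) (fun f p₀ => ?_) N f p₀
    · refine key.congr_left fun z => ?_
      simp only [Module.End.pow_apply]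
      rfl
    · have h1 : HasFDerivAt (fun r => f.1 r * F.1 r)
          (fderiv ℝ (fun r => f.1 r * F.1 r) (p + x • e)) (p + x • e) :=
        ((differentiableAt_smoothMaps f _).mul (differentiableAt_smoothMaps F _)).hasFDerivAt
      have h2 : HasDerivAt (fun y : ℝ => p + y • e) e x := by
        simpa using ((hasDerivAt_id x).smul_const e).const_add p
      have h3 := (h1.comp_hasDerivAt x h2).mul_const (G.1 p)
      refine (h3.congr_deriv ?_).congr_of_eventuallyEq (Eventually.of_forall fun y => ?_)
      · rw [twistedDeriv_apply, mul_assoc, ← mul_assoc (G.1 _), hGF, one_mul]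
      · simp [mul_assoc]
    · have hf := (contDiff_smoothMaps f).continuous
      have : Continuous fun z : ℝ × (ℝ × ℝ) =>
        f.1 (z.2 + z.1 • e) * (F.1 (z.2 + z.1 • e) * G.1 z.2) := by fun_prop
      exact this.continuousAt.tendsto.isBigO_one ℝ

/-- The constant map `1`. -/
def smoothOne : smoothMaps 𝔸 := ⟨fun _ => 1, contDiff_const (𝕜 := ℝ) (n := ∞) (c := (1 : 𝔸))⟩

@[simp]
theorem smoothOne_apply (p : ℝ × ℝ) : (smoothOne : smoothMaps 𝔸).1 p = 1 := rfl

end SmoothMaps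

section Order

open MulOpposite PowerSeries

variable {𝓗 : Type*} [NormedAddCommGroup 𝓗] [InnerProductSpace ℂ 𝓗] [CompleteSpace 𝓗]

/-- On the diagonal of the plane of pairs of times, the sum of the two generators is
`f ↦ f' - i f H` if the derivative of `F(u, v)` in `u` is `-i H` there. Hence it generates the
exact evolution. -/
theorem isBigO_exact_sub_taylor {F G : smoothMaps (𝓗 →L[ℂ] 𝓗)} {H : ℝ → 𝓗 →L[ℂ] 𝓗}
    (hH : Continuous H) (hF : ∀ t, F.1 (t, t) = 1) (hG : ∀ t, G.1 (t, t) = 1)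
    (hd : ∀ t, HasDerivAt (fun y => F.1 (y, t)) ((-Complex.I) • H t) t) (N : ℕ) (t₀ : ℝ) :
    (fun z : ℝ × ℝ => timeOrderedExp H (z.2 + z.1) z.2 -
      ∑ k ∈ Finset.range N, (z.1 ^ k / (k.factorial : ℝ)) •
        (((twistedDeriv (𝔸 := 𝓗 →L[ℂ] 𝓗) smoothOne smoothOne (0, 1) + twistedDeriv F G (1, 0)) ^ k)
          smoothOne).1 (z.2, z.2)) =O[𝓝 (0, t₀)] fun z => z.1 ^ N := by
  set X : Module.End ℝ (smoothMaps (𝓗 →L[ℂ] 𝓗)) :=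
    twistedDeriv smoothOne smoothOne (0, 1) + twistedDeriv F G (1, 0) with hX
  have key := isBigO_flow_sub_taylor (fun f => X f)
    (fun f t => f.1 (t, t)) (fun f x t => f.1 (t + x, t + x) * timeOrderedExp H (t + x) t)
    (fun f t => by simp) (fun f x t => ?_) (fun f t₀ => ?_) N smoothOne t₀
  · refine key.congr_left fun z => ?_
    simp only [Module.End.pow_apply, smoothOne_apply, one_mul]
  -- The flow of the sum is `f ↦ f(t + x, t + x) U_ex(t + x, t)`: its derivative splits into the two
  -- partial derivatives of `f` and the derivative `-i H` of `F` on the diagonal.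
  · have h1 : ∀ (g : smoothMaps (𝓗 →L[ℂ] 𝓗)) (p : ℝ × ℝ), HasFDerivAt g.1 (fderiv ℝ g.1 p) p :=
      fun g p => (differentiableAt_smoothMaps g p).hasFDerivAt
    have h2 : HasDerivAt (fun y : ℝ => (t + y, t + y)) ((1 : ℝ), (1 : ℝ)) x :=
      ((hasDerivAt_id x).const_add t).prodMk ((hasDerivAt_id x).const_add t)
    have h3 := ((h1 f (t + x, t + x)).comp_hasDerivAt x h2).mul
      ((hasDerivAt_timeOrderedExp hH t (t + x)).comp_const_add t x)
    refine h3.congr_deriv ?_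
    have h4 : HasDerivAt (fun y : ℝ => (y, t + x)) ((1 : ℝ), (0 : ℝ)) (t + x) :=
      (hasDerivAt_id _).prodMk (hasDerivAt_const _ _)
    have h5 := ((h1 F (t + x, t + x)).comp_hasDerivAt (f := fun y => (y, t + x)) (t + x)
      h4).unique (hd (t + x))
    have h6 := ((h1 f (t + x, t + x)).mul' (h1 F (t + x, t + x))).fderiv
    have h7 : fderiv ℝ f.1 (t + x, t + x) (1, 1) = fderiv ℝ f.1 (t + x, t + x) (0, 1) +
        fderiv ℝ f.1 (t + x, t + x) (1, 0) := by
      rw [← map_add]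
      simp
    have h8 : (twistedDeriv smoothOne smoothOne (0, 1) f).1 (t + x, t + x) =
        fderiv ℝ f.1 (t + x, t + x) (0, 1) := by
      simp [twistedDeriv_apply]
    have h9 : (twistedDeriv F G (1, 0) f).1 (t + x, t + x) =
        f.1 (t + x, t + x) * ((-Complex.I) • H (t + x)) + fderiv ℝ f.1 (t + x, t + x) (1, 0) := by
      rw [twistedDeriv_apply, hG, mul_one]
      refine (congrArg (fun T : ℝ × ℝ →L[ℝ] (𝓗 →L[ℂ] 𝓗) => T (1, 0)) h6).trans ?_
      rw [← h5]
      simp [hF]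
    rw [hX, LinearMap.add_apply, Submodule.coe_add, Pi.add_apply, h8, h9]
    simp only [Function.comp]
    rw [h7]
    noncomm_ring
  · have hc : Continuous fun z : ℝ × ℝ => f.1 (z.2 + z.1, z.2 + z.1) := by
      have := (contDiff_smoothMaps f).continuous
      fun_prop
    simpa using (hc.continuousAt.tendsto.isBigO_one ℝ).mul (isBigO_one_timeOrderedExp hH t₀)

/-- The composition of a one-step method `F` with its adjoint, described as the splitting of the two
flows that move the first and the second argument of `F`, has the order of the splitting. -/
theorem IsProductFormulaOfOrder.isBigO_composeFlows {n q : ℕ} {a b : ℕ → ℝ}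
    (hab : IsProductFormulaOfOrder n q a b) {F G : smoothMaps (𝓗 →L[ℂ] 𝓗)}
    {H : ℝ → 𝓗 →L[ℂ] 𝓗} (hH : Continuous H) (hFG : ∀ p, F.1 p * G.1 p = 1)
    (hGF : ∀ p, G.1 p * F.1 p = 1) (hF : ∀ t, F.1 (t, t) = 1)
    (hd : ∀ t, HasDerivAt (fun y => F.1 (y, t)) ((-Complex.I) • H t) t) (t₀ : ℝ) :
    (fun z : ℝ × ℝ => composeFlows a b (fun x p => p + x • ((0 : ℝ), (1 : ℝ))) (fun _ _ => 1)
        (fun x p => p + x • ((1 : ℝ), (0 : ℝ)))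
        (fun x p => F.1 (p + x • ((1 : ℝ), (0 : ℝ))) * G.1 p) (fun _ => 1) q z.1 (z.2, z.2) -
      timeOrderedExp H (z.2 + z.1) z.2) =O[𝓝 (0, t₀)] fun z => z.1 ^ (n + 1) := by
  have hG : ∀ t, G.1 (t, t) = 1 := fun t => by
    have := hFG (t, t)
    rwa [hF, one_mul] at this
  have hA : IsFlow (smoothMaps (𝓗 →L[ℂ] 𝓗)).subtype
      (twistedDeriv (𝔸 := 𝓗 →L[ℂ] 𝓗) smoothOne smoothOne (0, 1))
      (fun x p => p + x • ((0 : ℝ), (1 : ℝ))) (fun _ _ => 1) := by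
    simpa using isFlow_twistedDeriv (𝔸 := 𝓗 →L[ℂ] 𝓗) (F := smoothOne) (G := smoothOne) (by simp)
      (by simp) (0, 1)
  have hB := isFlow_twistedDeriv hFG hGF (1, 0)
  have h1 := hasExpansion_composeFlows (n + 1) smoothOne
    (fun p₀ => isBigO_const_const (1 : 𝓗 →L[ℂ] 𝓗) one_ne_zero _) hA hB a b q
  have ht : Tendsto (fun z : ℝ × ℝ => (z.1, (z.2, z.2))) (𝓝 (0, t₀)) (𝓝 (0, (t₀, t₀))) := by
    have : Continuous fun z : ℝ × ℝ => (z.1, (z.2, z.2)) := by fun_prop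
    exact this.tendsto (0, t₀)
  refine (((h1 (t₀, t₀)).comp_tendsto ht).sub
    (isBigO_exact_sub_taylor hH hF hG hd (n + 1) t₀)).congr_left fun z => ?_
  -- Both expansions have the same coefficients, by the order conditions in the opposite of the
  -- algebra of operators on smooth maps.
  refine (sub_sub_sub_comm _ _ _ _).trans (sub_eq_self.2 (sub_eq_zero.2 ?_))
  refine Finset.sum_congr rfl fun k hk => ?_
  have h2 := hab.coeff_formalProd
    (op (twistedDeriv (𝔸 := 𝓗 →L[ℂ] 𝓗) smoothOne smoothOne (0, 1)))
    (op (twistedDeriv F G (1, 0))) (Nat.lt_succ_iff.1 (Finset.mem_range.1 hk))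
  have h3 : ∀ A B : Module.End ℝ (smoothMaps (𝓗 →L[ℂ] 𝓗)), coeff k (formalExp 1 (op A + op B)) =
      op ((1 / (k.factorial : ℝ)) • (A + B) ^ k) := fun A B => by
    rw [coeff_formalExp, one_pow, ← op_add, ← op_pow, ← op_smul]
  rw [h3] at h2
  simp only [h2, unop_op, LinearMap.smul_apply, map_smul, Pi.smul_apply, smul_smul,
    mul_one_div]
  rfl

end Order

/-! ### Ordered products -/

section OrderedProducts

theorem contDiff_list_prod {E 𝔸 ι : Type*} [NormedAddCommGroup E] [NormedSpace ℝ E] [NormedRing 𝔸]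
    [NormedAlgebra ℝ 𝔸] (l : List ι) (f : ι → E → 𝔸) (hf : ∀ k ∈ l, ContDiff ℝ ∞ (f k)) :
    ContDiff ℝ ∞ fun x => (l.map fun k => f k x).prod := by
  induction l with
  | nil => exact contDiff_const
  | cons k l ih =>
    simp only [List.map_cons, List.prod_cons]
    exact (hf k (by simp)).mul (ih fun j hj => hf j (by simp [hj]))

/-- At a point where all factors are `1`, the derivative of an ordered product is the sum of the
derivatives. -/
theorem hasDerivAt_list_prod_of_eq_one {𝔸 ι : Type*} [NormedRing 𝔸] [NormedAlgebra ℝ 𝔸]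
    (l : List ι) (f : ι → ℝ → 𝔸) (f' : ι → 𝔸) {x : ℝ} (h1 : ∀ k, f k x = 1)
    (hf : ∀ k ∈ l, HasDerivAt (f k) (f' k) x) :
    HasDerivAt (fun x => (l.map fun k => f k x).prod) (l.map f').sum x := by
  induction l with
  | nil => exact hasDerivAt_const _ _
  | cons k l ih =>
    simp only [List.map_cons, List.prod_cons, List.sum_cons]
    have h2 : (l.map fun k => f k x).prod = 1 := by simp [h1]
    have h3 := (hf k (by simp)).fun_mul (ih fun j hj => hf j (by simp [hj]))
    rwa [h1, h2, mul_one, one_mul] at h3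

theorem mem_range'_iff {m n k : ℕ} : k ∈ List.range' m (n + 1 - m) ↔ m ≤ k ∧ k ≤ n := by
  rw [List.mem_range'_1]
  omega

theorem forwardProd_congr {M : Type*} [Monoid M] {m n : ℕ} {f g : ℕ → M}
    (h : ∀ k, m ≤ k → k ≤ n → f k = g k) : forwardProd m n f = forwardProd m n g := by
  rw [forwardProd, forwardProd]
  refine congrArg List.prod (List.map_congr_left fun k hk => ?_)
  rw [mem_range'_iff] at hk
  exact h k hk.1 hk.2

theorem list_prod_mul_reverse_prod {M ι : Type*} [Monoid M] (l : List ι) {f g : ι → M}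
    (h : ∀ k, f k * g k = 1) : (l.map f).prod * (l.reverse.map g).prod = 1 := by
  induction l with
  | nil => simp
  | cons k l ih =>
    rw [List.reverse_cons, List.map_append, List.prod_append, List.map_cons, List.prod_cons,
      mul_assoc, ← mul_assoc _ (List.prod _) (List.prod _), ih]
    simp [h]

theorem forwardProd_mul_backwardProd {M : Type*} [Monoid M] (m n : ℕ) {f g : ℕ → M}
    (h : ∀ k, f k * g k = 1) : forwardProd m n f * backwardProd n m g = 1 :=
  list_prod_mul_reverse_prod _ h

theorem backwardProd_mul_forwardProd {M : Type*} [Monoid M] (m n : ℕ) {f g : ℕ → M}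
    (h : ∀ k, f k * g k = 1) : backwardProd n m f * forwardProd m n g = 1 := by
  have := list_prod_mul_reverse_prod (List.range' m (n + 1 - m)).reverse h
  rwa [List.reverse_reverse] at this

end OrderedProducts

/-! ### The one-step method and its adjoint -/

section Blocks

theorem blockF_self {𝓗 : Type*} [NormedAddCommGroup 𝓗] [InnerProductSpace ℂ 𝓗] (Λ Λ' : ℕ)
    (H : ℕ → ℝ → 𝓗 →L[ℂ] 𝓗) (t : ℝ) : blockF Λ Λ' H t t = 1 := by
  simp [blockF, forwardProd]

variable {𝓗 : Type*} [NormedAddCommGroup 𝓗] [InnerProductSpace ℂ 𝓗] [CompleteSpace 𝓗]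
  {Λ Λ' : ℕ} {H : ℕ → ℝ → 𝓗 →L[ℂ] 𝓗}

theorem contDiff_exp {𝔸 : Type*} [NormedRing 𝔸] [NormedAlgebra ℝ 𝔸] [CompleteSpace 𝔸] :
    ContDiff ℝ ∞ (NormedSpace.exp : 𝔸 → 𝔸) :=
  contDiff_iff_contDiffAt.2 fun x => (NormedSpace.exp_analytic (𝕂 := ℝ) x).contDiffAt

theorem contDiff_evolve {E : Type*} [NormedAddCommGroup E] [NormedSpace ℝ E] {A : E → 𝓗 →L[ℂ] 𝓗}
    {τ : E → ℝ} (hA : ContDiff ℝ ∞ A) (hτ : ContDiff ℝ ∞ τ) :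
    ContDiff ℝ ∞ fun x => evolve (A x) (τ x) := by
  have h1 : ContDiff ℝ ∞ fun x => -(Complex.I * (τ x : ℂ)) :=
    (contDiff_const.mul (Complex.ofRealCLM.contDiff.comp hτ)).neg
  have h2 : ContDiff ℝ ∞ fun x => (-(Complex.I * (τ x : ℂ))) • A x := h1.smul hA
  exact contDiff_exp.comp h2

/-- At duration `0` the generator may vary with time without contributing to the derivative. -/
theorem hasDerivAt_evolve_of_eq_zero {A : ℝ → 𝓗 →L[ℂ] 𝓗} {t : ℝ} (hA : DifferentiableAt ℝ A t) :
    HasDerivAt (fun y => evolve (A y) (y - t)) ((-Complex.I) • A t) t := by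
  have h1 : HasDerivAt (fun y : ℝ => (y - t) • ((-Complex.I) • A y)) ((-Complex.I) • A t) t := by
    have h2 := ((hasDerivAt_id t).sub_const t).fun_smul ((hA.hasDerivAt).const_smul (-Complex.I))
    simpa using h2
  have h3 : HasFDerivAt (NormedSpace.exp : (𝓗 →L[ℂ] 𝓗) → 𝓗 →L[ℂ] 𝓗)
      (1 : (𝓗 →L[ℂ] 𝓗) →L[ℝ] 𝓗 →L[ℂ] 𝓗) ((t - t) • ((-Complex.I) • A t)) := by
    rw [sub_self, zero_smul]
    exact hasFDerivAt_exp_zero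
  refine (h3.comp_hasDerivAt t h1).congr_of_eventuallyEq (Eventually.of_forall fun y => ?_)
  simp only [Function.comp, evolve]
  rw [← Complex.coe_smul, smul_smul]
  congr 2
  ring

theorem contDiff_blockF (hΛ' : Λ' ≤ Λ) (hH : ∀ k ∈ Finset.Icc 1 Λ, ContDiff ℝ ∞ (H k)) :
    ContDiff ℝ ∞ fun p : ℝ × ℝ => blockF Λ Λ' H p.1 p.2 := by
  refine ContDiff.mul (contDiff_list_prod _ _ fun k hk => ?_)
    (contDiff_list_prod _ _ fun k hk => ?_)
  all_goals
    rw [mem_range'_iff] at hk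
    have hk' := hH k (Finset.mem_Icc.2 (by omega))
  · exact contDiff_evolve (hk'.comp contDiff_fst) (contDiff_fst.sub contDiff_snd)
  · exact contDiff_evolve (hk'.comp contDiff_snd) (contDiff_fst.sub contDiff_snd)

theorem contDiff_blockB (hΛ' : Λ' ≤ Λ) (hH : ∀ k ∈ Finset.Icc 1 Λ, ContDiff ℝ ∞ (H k)) :
    ContDiff ℝ ∞ fun p : ℝ × ℝ => blockB Λ Λ' H p.2 p.1 := by
  refine ContDiff.mul (contDiff_list_prod _ _ fun k hk => ?_)
    (contDiff_list_prod _ _ fun k hk => ?_)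
  all_goals
    rw [List.mem_reverse, mem_range'_iff] at hk
    have hk' := hH k (Finset.mem_Icc.2 (by omega))
  · exact contDiff_evolve (hk'.comp contDiff_snd) (contDiff_snd.sub contDiff_fst)
  · exact contDiff_evolve (hk'.comp contDiff_fst) (contDiff_snd.sub contDiff_fst)

/-- The backward block is the adjoint of the forward block: `U_B(t', t) = U_F(t, t')⁻¹`. -/
theorem blockF_mul_blockB (Λ Λ' : ℕ) (H : ℕ → ℝ → 𝓗 →L[ℂ] 𝓗) (u v : ℝ) :
    blockF Λ Λ' H u v * blockB Λ Λ' H v u = 1 := by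
  rw [blockF, blockB, mul_assoc, ← mul_assoc (forwardProd (Λ' + 1) Λ _),
    forwardProd_mul_backwardProd _ _ fun k => evolve_mul_evolve_neg _ (by ring), one_mul,
    forwardProd_mul_backwardProd _ _ fun k => evolve_mul_evolve_neg _ (by ring)]

theorem blockB_mul_blockF (Λ Λ' : ℕ) (H : ℕ → ℝ → 𝓗 →L[ℂ] 𝓗) (u v : ℝ) :
    blockB Λ Λ' H v u * blockF Λ Λ' H u v = 1 := by
  rw [blockF, blockB, mul_assoc, ← mul_assoc (backwardProd Λ' 1 _),
    backwardProd_mul_forwardProd _ _ fun k => evolve_mul_evolve_neg _ (by ring), one_mul,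
    backwardProd_mul_forwardProd _ _ fun k => evolve_mul_evolve_neg _ (by ring)]

theorem list_range'_map_sum {M : Type*} [AddCommMonoid M] (f : ℕ → M) (m n : ℕ) :
    ((List.range' m n).map f).sum = ∑ k ∈ Finset.Ico m (m + n), f k := by
  induction n with
  | zero => simp
  | succ n ih =>
    rw [List.range'_concat, List.map_append, List.sum_append, ih, ← add_assoc,
      Finset.sum_Ico_succ_top (by omega)]
    simp

theorem hasDerivAt_blockF (hΛ' : Λ' ≤ Λ) (hH : ∀ k ∈ Finset.Icc 1 Λ, ContDiff ℝ ∞ (H k)) (t : ℝ) :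
    HasDerivAt (fun y => blockF Λ Λ' H y t)
      ((-Complex.I) • ∑ k ∈ Finset.Icc 1 Λ, H k t) t := by
  have hdiff : ∀ k ∈ Finset.Icc 1 Λ, DifferentiableAt ℝ (H k) t := fun k hk =>
    ((hH k hk).differentiable (by simp)).differentiableAt
  have h1 := hasDerivAt_list_prod_of_eq_one (List.range' 1 (Λ' + 1 - 1))
    (fun k y => evolve (H k y) (y - t)) (fun k => (-Complex.I) • H k t) (x := t)
    (fun k => by simp) (fun k hk => by
      rw [mem_range'_iff] at hk
      exact hasDerivAt_evolve_of_eq_zero (hdiff k (Finset.mem_Icc.2 (by omega))))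
  have h2 := hasDerivAt_list_prod_of_eq_one (List.range' (Λ' + 1) (Λ + 1 - (Λ' + 1)))
    (fun k y => evolve (H k t) (y - t)) (fun k => (-Complex.I) • H k t) (x := t)
    (fun k => by simp) (fun k _ => hasDerivAt_evolve_of_eq_zero (differentiableAt_const _))
  refine (h1.fun_mul h2).congr_deriv ?_
  have h3 : ∀ l : List ℕ, (l.map fun k => evolve (H k t) (t - t)).prod = 1 := fun l => by simp
  have h4 : Finset.Icc 1 Λ = Finset.Ico 1 (Λ + 1) := by ext; simp
  rw [h3, h3, mul_one, one_mul, list_range'_map_sum, list_range'_map_sum, Finset.smul_sum, h4,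
    ← Finset.sum_Ico_consecutive _ (show 1 ≤ Λ' + 1 by omega) (show Λ' + 1 ≤ Λ + 1 by omega)]
  congr 3
  all_goals omega

end Blocks

/-! ### Sums of the coefficients -/

section CoefficientSums

open PowerSeries

/-- The terms of orders `0` and `1`, which suffice to express consistency. -/
theorem coeff_one_formalProd (a b : ℕ → ℝ) (q : ℕ) (A B : ℝ) :
    coeff 0 (formalProd a b A B q) = 1 ∧ coeff 1 (formalProd a b A B q) =
      (∑ k ∈ Finset.Icc 1 (q + 1), a k) * A + (∑ k ∈ Finset.Icc 1 q, b k) * B := by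
  induction q with
  | zero => simp [formalProd]
  | succ q ih =>
    have hm : ∀ P Q : PowerSeries ℝ,
        coeff 1 (P * Q) = coeff 0 P * coeff 1 Q + coeff 1 P * coeff 0 Q :=
      fun P Q => by simp [coeff_mul, Finset.Nat.antidiagonal_succ]
    have h0 : ∀ P Q : PowerSeries ℝ, coeff 0 (P * Q) = coeff 0 P * coeff 0 Q := fun P Q => by
      simp [coeff_mul]
    rw [formalProd, hm, h0, hm, h0, ih.1, ih.2,
      Finset.sum_Icc_succ_top (show 1 ≤ q + 1 + 1 by omega) a,
      Finset.sum_Icc_succ_top (by omega) b]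
    constructor
    · simp
    · simp
      ring

theorem IsProductFormulaOfOrder.sum_eq_one {n q : ℕ} {a b : ℕ → ℝ}
    (hab : IsProductFormulaOfOrder n q a b) (hn : 1 ≤ n) :
    ∑ k ∈ Finset.Icc 1 (q + 1), a k = 1 ∧ ∑ k ∈ Finset.Icc 1 q, b k = 1 := by
  have h1 := hab.coeff_formalProd (1 : ℝ) 0 hn
  have h2 := hab.coeff_formalProd (0 : ℝ) 1 hn
  rw [(coeff_one_formalProd a b q _ _).2] at h1 h2
  simp at h1 h2
  exact ⟨h1, h2⟩

theorem coeffC_add_coeffD (a b : ℕ → ℝ) {k : ℕ} (hk : 1 ≤ k) :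
    coeffC a b k + coeffD a b k = b k := by
  obtain ⟨k, rfl⟩ := Nat.exists_eq_succ_of_ne_zero (by omega : k ≠ 0)
  simp [coeffC, coeffD]

theorem coeffD_add_coeffC_succ (a b : ℕ → ℝ) (k : ℕ) :
    coeffD a b k + coeffC a b (k + 1) = a (k + 1) := by
  simp [coeffC]

theorem sum_coeff_eq (a b : ℕ → ℝ) (i q : ℕ) :
    ∑ j ∈ Finset.Icc (i + 1) q, (coeffC a b j + coeffD a b j) = ∑ j ∈ Finset.Icc (i + 1) q, b j :=
  Finset.sum_congr rfl fun _ hj => coeffC_add_coeffD a b (by have := Finset.mem_Icc.1 hj; omega)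

/-- The left-hand side is `R_i / Δt`. Once `d_q = a_{q+1}` is known, the right-hand side is the sum
of all `a_j` with `j > i`. -/
theorem coeffD_add_sum (a b : ℕ → ℝ) {i q : ℕ} (hi : i ≤ q) :
    coeffD a b i + ∑ j ∈ Finset.Icc (i + 1) q, (coeffC a b j + coeffD a b j) =
      ∑ j ∈ Finset.Icc (i + 1) q, a j + coeffD a b q := by
  induction q, hi using Nat.le_induction with
  | base => simp
  | succ q hq ih =>
    rw [Finset.sum_Icc_succ_top (by omega), Finset.sum_Icc_succ_top (by omega), ← add_assoc, ih,
      ← coeffD_add_coeffC_succ a b q]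
    ring

/-- The product formula ends with `e^{A a_{q+1} x}`, and consistency makes `a_{q+1}` equal to the
last coefficient `d_q`, which has no successor `c_{q+1}` to be combined with. -/
theorem IsProductFormulaOfOrder.coeffD_eq {n q : ℕ} {a b : ℕ → ℝ}
    (hab : IsProductFormulaOfOrder n q a b) (hn : 1 ≤ n) : coeffD a b q = a (q + 1) := by
  obtain ⟨h1, h2⟩ := hab.sum_eq_one hn
  have h3 := coeffD_add_sum a b (Nat.zero_le q)
  rw [sum_coeff_eq, zero_add, h2] at h3
  rw [Finset.sum_Icc_succ_top (by omega)] at h1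
  simp only [coeffD] at h3
  linarith

end CoefficientSums

/-! ### The order of the time-dependent scheme -/

section Order

variable {𝓗 : Type*} [NormedAddCommGroup 𝓗] [InnerProductSpace ℂ 𝓗] [CompleteSpace 𝓗]

/-- The composed flows, written out as an ordered product: in the `i`-th factor the first time moves
from `∑_{k>i} b_k` to `∑_{k≥i} b_k`, while the second one has been moved to `∑_{k>i} a_k`. -/
theorem composeFlows_eq_forwardProd {𝔸 : Type*} [NormedRing 𝔸] (F G : ℝ × ℝ → 𝔸) (a b : ℕ → ℝ)
    (q : ℕ) (x u v : ℝ) :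
    composeFlows a b (fun x p => p + x • ((0 : ℝ), (1 : ℝ))) (fun _ _ => 1)
        (fun x p => p + x • ((1 : ℝ), (0 : ℝ)))
        (fun x p => F (p + x • ((1 : ℝ), (0 : ℝ))) * G p) (fun _ => 1) q x (u, v) =
      forwardProd 1 q fun i =>
        F (u + x * ∑ k ∈ Finset.Icc i q, b k, v + x * ∑ k ∈ Finset.Icc (i + 1) (q + 1), a k) *
        G (u + x * ∑ k ∈ Finset.Icc (i + 1) q, b k,
          v + x * ∑ k ∈ Finset.Icc (i + 1) (q + 1), a k) := by
  induction q generalizing u v with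
  | zero => simp [composeFlows, forwardProd]
  | succ q ih =>
    rw [composeFlows, mul_one]
    have h1 : ((u, v) + (a (q + 2) * x) • ((0 : ℝ), (1 : ℝ)) : ℝ × ℝ) =
      (u, v + a (q + 2) * x) := by simp
    have h2 : ((u, v + a (q + 2) * x) + (b (q + 1) * x) • ((1 : ℝ), (0 : ℝ)) : ℝ × ℝ) =
      (u + b (q + 1) * x, v + a (q + 2) * x) := by simp
    rw [h1, h2, ih, forwardProd_succ_right]
    congr 1
    · refine forwardProd_congr fun i hi1 hi2 => ?_
      rw [Finset.sum_Icc_succ_top (by omega : i ≤ q + 1) b,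
        Finset.sum_Icc_succ_top (by omega : i + 1 ≤ q + 1) b,
        Finset.sum_Icc_succ_top (by omega : i + 1 ≤ q + 1 + 1) a]
      congr 3 <;> ring
    · simp [mul_comm]

theorem approximatesToOrder_timeDepScheme {n q Λ Λ' : ℕ} (hn : 1 ≤ n) (hΛ' : Λ' ≤ Λ)
    {a b : ℕ → ℝ} (hab : IsProductFormulaOfOrder n q a b) (H : ℕ → ℝ → 𝓗 →L[ℂ] 𝓗)
    (hH : ∀ k ∈ Finset.Icc 1 Λ, ContDiff ℝ ∞ (H k)) :
    ApproximatesToOrder n Λ H (timeDepScheme q Λ Λ' a b H) := by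
  intro t₀
  let F : smoothMaps (𝓗 →L[ℂ] 𝓗) := ⟨fun p => blockF Λ Λ' H p.1 p.2, contDiff_blockF hΛ' hH⟩
  let G : smoothMaps (𝓗 →L[ℂ] 𝓗) := ⟨fun p => blockB Λ Λ' H p.2 p.1, contDiff_blockB hΛ' hH⟩
  have hHc : Continuous fun s => ∑ k ∈ Finset.Icc 1 Λ, H k s :=
    continuous_finsetSum _ fun k hk => (hH k hk).continuous
  have key := hab.isBigO_composeFlows (F := F) (G := G) hHc (fun p => blockF_mul_blockB _ _ _ _ _)
    (fun p => blockB_mul_blockF _ _ _ _ _) (fun t => blockF_self _ _ _ _)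
    (hasDerivAt_blockF hΛ' hH) t₀
  have ht : Tendsto (fun p : ℝ × ℝ => (p.2, p.1)) (𝓝 (t₀, 0)) (𝓝 (0, t₀)) :=
    continuous_swap.tendsto (t₀, (0 : ℝ))
  refine (key.comp_tendsto ht).congr_left fun p => ?_
  simp only [Function.comp]
  rw [composeFlows_eq_forwardProd]
  congr 1
  refine (forwardProd_congr fun i hi1 hi2 => ?_)
  obtain ⟨i, rfl⟩ := Nat.exists_eq_succ_of_ne_zero (by omega : i ≠ 0)
  have h1 := coeffD_add_sum a b hi2
  rw [hab.coeffD_eq hn, ← Finset.sum_Icc_succ_top (by omega)] at h1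
  simp only [nodeL, nodeR, Nat.succ_eq_add_one] at h1 ⊢
  rw [h1, sum_coeff_eq, sum_coeff_eq]

end Order

/-! ### Counting runs of equal labels -/

section Runs

variable {ι : Type*}

open Classical in
/-- The number of maximal runs of equal consecutive entries of a list. -/
noncomputable def numRuns : List ι → ℕ
  | [] => 0
  | [_] => 1
  | x :: y :: l => numRuns (y :: l) + if x = y then 0 else 1

open Classical in
theorem numRuns_cons {x : ι} {l : List ι} :
    numRuns (x :: l) = numRuns l + if l.head? = some x then 0 else 1 := by
  cases l with
  | nil => simp [numRuns]
  | cons y l => simp [numRuns, eq_comm]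

/-- The two claims are proved together: whether `consGate` merges is decided by the first label. -/
theorem length_mergeGates_and_head? (l : List (Gate ι)) :
    (mergeGates l).length = numRuns (l.map Gate.label) ∧
      ((mergeGates l).map Gate.label).head? = (l.map Gate.label).head? := by
  classical
  induction l with
  | nil => simp [mergeGates, numRuns]
  | cons g l ih =>
    have h1 : mergeGates (g :: l) = consGate g (mergeGates l) := rfl
    rw [h1, List.map_cons, numRuns_cons, ← ih.1, ← ih.2]
    cases h2 : mergeGates l with
    | nil => simp [consGate]
    | cons g' m =>
      by_cases h3 : g.label = g'.label
      · simp [consGate, h3]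
      · simp [consGate, h3, Ne.symm h3]

theorem length_mergeGates (l : List (Gate ι)) :
    (mergeGates l).length = numRuns (l.map Gate.label) :=
  (length_mergeGates_and_head? l).1

theorem numRuns_eq_length_of_nodup {l : List ι} (h : l.Nodup) : numRuns l = l.length := by
  classical
  induction l with
  | nil => rfl
  | cons x l ih =>
    rw [List.nodup_cons] at h
    rw [numRuns_cons, ih h.2, List.length_cons,
      if_neg fun h1 : l.head? = some x => h.1 (List.mem_of_mem_head? h1)]

open Classical in
theorem numRuns_append_add {l m : List ι} (hl : l ≠ []) (hm : m ≠ []) :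
    numRuns (l ++ m) + (if l.getLast? = m.head? then 1 else 0) = numRuns l + numRuns m := by
  induction l with
  | nil => exact absurd rfl hl
  | cons x l ih =>
    cases l with
    | nil =>
      obtain ⟨y, m, rfl⟩ := List.exists_cons_of_ne_nil hm
      by_cases h : x = y
      · simp [numRuns, h, add_comm]
      · simp [numRuns, h, add_comm]
    | cons z l =>
      have h1 := ih (by simp)
      simp only [List.cons_append, numRuns, List.getLast?_cons_cons] at h1 ⊢
      omega

open Classical in
/-- In a concatenation of nonempty blocks, a run is lost for each pair of neighbouring blocks that
meet in equal entries. -/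
theorem numRuns_flatMap_add (X : ℕ → List ι) (hX : ∀ j, X j ≠ []) (s q : ℕ) :
    numRuns ((List.range' s (q + 1)).flatMap X) +
        ∑ j ∈ Finset.range q, (if (X (s + j)).getLast? = (X (s + j + 1)).head? then 1 else 0) =
      ∑ j ∈ Finset.range (q + 1), numRuns (X (s + j)) := by
  have hlast : ∀ q, ((List.range' s (q + 1)).flatMap X).getLast? = (X (s + q)).getLast? := by
    intro q
    rw [List.range'_concat, List.flatMap_append]
    simp [List.getLast?_append_of_ne_nil _ (hX _)]
  induction q with
  | zero => simp
  | succ q ih =>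
    rw [List.range'_concat, List.flatMap_append, Finset.sum_range_succ _ (q + 1), ← ih,
      Finset.sum_range_succ]
    have h1 : (List.range' s (q + 1)).flatMap X ≠ [] := by
      rw [List.range'_succ, List.flatMap_cons]
      simp [hX]
    have h2 := numRuns_append_add h1 (hX (s + (q + 1)))
    rw [hlast] at h2
    simp only [one_mul, List.flatMap_cons, List.flatMap_nil, List.append_nil] at h2 ⊢
    rw [← add_assoc] at h2
    rw [← add_assoc s q 1]
    omega

open Classical in
/-- A zigzag list runs through the indices `1, …, Λ` and back, `q` times. Each of the `2q - 1`
turning points where the labels on the two sides agree costs one run. -/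
theorem numRuns_zigzag_add {q Λ : ℕ} (hq : 1 ≤ q) (hΛ : 1 ≤ Λ) (φ ψ : ℕ → ℕ → ι)
    (hφ : ∀ j, Function.Injective (φ j)) (hψ : ∀ j, Function.Injective (ψ j)) :
    numRuns ((List.range' 1 q).flatMap fun j =>
        (List.range' 1 Λ).map (φ j) ++ (List.range' 1 Λ).reverse.map (ψ j)) +
      ∑ j ∈ Finset.range (q - 1), (if ψ (j + 1) 1 = φ (j + 2) 1 then 1 else 0) +
      ∑ j ∈ Finset.range q, (if φ (j + 1) Λ = ψ (j + 1) Λ then 1 else 0) = 2 * Λ * q := by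
  obtain ⟨q, rfl⟩ := Nat.exists_eq_succ_of_ne_zero (by omega : q ≠ 0)
  obtain ⟨Λ, rfl⟩ := Nat.exists_eq_succ_of_ne_zero (by omega : Λ ≠ 0)
  set X : ℕ → List ι := fun j => (List.range' 1 (Λ + 1)).map (φ j) ++
    (List.range' 1 (Λ + 1)).reverse.map (ψ j) with hX
  have hne : ∀ j, X j ≠ [] := fun j => by simp [hX]
  have hhead : ∀ j, (X j).head? = some (φ j 1) := fun j => by
    simp [hX, List.range'_succ]
  have hlast : ∀ j, (X j).getLast? = some (ψ j 1) := fun j => by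
    simp only [hX]
    rw [List.range'_succ, List.reverse_cons, List.map_append, ← List.append_assoc]
    exact List.getLast?_concat
  have hblock : ∀ j, numRuns (X j) + (if φ j (Λ + 1) = ψ j (Λ + 1) then 1 else 0) =
      2 * (Λ + 1) := by
    intro j
    have h1 := numRuns_append_add (l := (List.range' 1 (Λ + 1)).map (φ j))
      (m := (List.range' 1 (Λ + 1)).reverse.map (ψ j)) (by simp) (by simp)
    rw [numRuns_eq_length_of_nodup ((List.nodup_range').map (hφ j)),
      numRuns_eq_length_of_nodup ((List.nodup_reverse.2 List.nodup_range').map (hψ j))] at h1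
    have h2 : ((List.range' 1 (Λ + 1)).map (φ j)).getLast? = some (φ j (Λ + 1)) := by
      rw [List.range'_concat]
      simp [add_comm]
    have h3 : ((List.range' 1 (Λ + 1)).reverse.map (ψ j)).head? = some (ψ j (Λ + 1)) := by
      rw [List.range'_concat]
      simp [add_comm]
    rw [h2, h3] at h1
    simp only [Option.some_inj, List.length_map, List.length_reverse, List.length_range'] at h1
    simp only [hX]
    omega
  have h1 := numRuns_flatMap_add X hne 1 q
  simp only [hhead, hlast, Option.some_inj] at h1
  have h2 : ∑ j ∈ Finset.range (q + 1), (numRuns (X (1 + j)) +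
      if φ (1 + j) (Λ + 1) = ψ (1 + j) (Λ + 1) then 1 else 0) = (q + 1) * (2 * (Λ + 1)) := by
    simp [hblock]
  rw [Finset.sum_add_distrib, ← h1] at h2
  simp only [add_comm 1] at h2
  rw [Nat.succ_eq_add_one, Nat.succ_eq_add_one, Nat.add_sub_cancel, h2]
  ring

end Runs

/-! ### Numbers of merged gates -/

section Counting

theorem nodeL_eq {q k : ℕ} (hk : k ≤ q) (a b : ℕ → ℝ) (Δt : ℝ) :
    nodeL q a b Δt k = Δt * (coeffC a b k + coeffD a b k) + nodeL q a b Δt (k + 1) := by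
  have h : Finset.Icc (k + 1) q = Finset.Ioc k q := by
    ext
    simp only [Finset.mem_Icc, Finset.mem_Ioc]
    omega
  rw [nodeL, nodeL, ← Finset.add_sum_Ioc_eq_sum_Icc hk, mul_add, h]

theorem nodeR_eq (q : ℕ) (a b : ℕ → ℝ) (Δt : ℝ) (k : ℕ) :
    nodeR q a b Δt k = Δt * coeffD a b k + nodeL q a b Δt (k + 1) := by
  rw [nodeL, nodeR, mul_add]

theorem map_label_gatesF {Λ Λ' : ℕ} (hΛ' : Λ' ≤ Λ) (t' t : ℝ) :
    (gatesF Λ Λ' t' t).map Gate.label =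
      (List.range' 1 Λ).map fun k => (k, if k ≤ Λ' then t' else t) := by
  have h1 : List.range' 1 Λ = List.range' 1 Λ' ++ List.range' (Λ' + 1) (Λ - Λ') := by
    rw [add_comm Λ' 1, List.range'_append_1, Nat.add_sub_cancel' hΛ']
  rw [h1, gatesF, List.map_append, List.map_append, List.map_map, List.map_map]
  congr 1
  · refine List.map_congr_left fun k hk => ?_
    rw [List.mem_range'_1] at hk
    simp [show k ≤ Λ' by omega]
  · refine List.map_congr_left fun k hk => ?_
    rw [List.mem_range'_1] at hk
    simp [show ¬ k ≤ Λ' by omega]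

theorem map_label_gatesB {Λ Λ' : ℕ} (hΛ' : Λ' ≤ Λ) (t' t : ℝ) :
    (gatesB Λ Λ' t' t).map Gate.label =
      (List.range' 1 Λ).reverse.map fun k => (k, if k ≤ Λ' then t else t') := by
  have h1 : List.range' 1 Λ = List.range' 1 Λ' ++ List.range' (Λ' + 1) (Λ - Λ') := by
    rw [add_comm Λ' 1, List.range'_append_1, Nat.add_sub_cancel' hΛ']
  rw [h1, gatesB, List.reverse_append, List.map_append, List.map_append, List.map_map, List.map_map]
  congr 1
  · refine List.map_congr_left fun k hk => ?_
    rw [List.mem_reverse, List.mem_range'_1] at hk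
    simp [show ¬ k ≤ Λ' by omega]
  · refine List.map_congr_left fun k hk => ?_
    rw [List.mem_reverse, List.mem_range'_1] at hk
    simp [show k ≤ Λ' by omega]

theorem map_label_timeDepGates {Λ Λ' : ℕ} (hΛ' : Λ' ≤ Λ) (q : ℕ) (a b : ℕ → ℝ) :
    (timeDepGates q Λ Λ' a b).map Gate.label = (List.range' 1 q).flatMap fun j =>
      (List.range' 1 Λ).map (fun k => (k, if k ≤ Λ' then nodeL q a b 1 j else nodeR q a b 1 j)) ++
      (List.range' 1 Λ).reverse.map
        (fun k => (k, if k ≤ Λ' then nodeL q a b 1 (j + 1) else nodeR q a b 1 j)) := by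
  simp only [timeDepGates, List.map_flatMap, List.map_append, map_label_gatesF hΛ',
    map_label_gatesB hΛ']

open Classical in
/-- The number of merged gates for every `Λ'`. Between two cycles both labels have index `1`, and
the times agree if `1 ≤ Λ'` or if `R_{j+1} = R_{j+2}`, that is, `a_{j+2} = 0`. Inside a cycle both
labels have index `Λ`, and the times agree if `Λ' < Λ` or if `L_{j+1} = L_{j+2}`, that is,
`b_{j+1} = 0`. -/
theorem length_mergeGates_timeDepGates {q Λ Λ' : ℕ} (hq : 1 ≤ q) (hΛ : 1 ≤ Λ) (hΛ' : Λ' ≤ Λ)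
    (a b : ℕ → ℝ) :
    (mergeGates (timeDepGates q Λ Λ' a b)).length +
      ∑ j ∈ Finset.range (q - 1), (if 1 ≤ Λ' ∨ a (j + 2) = 0 then 1 else 0) +
      ∑ j ∈ Finset.range q, (if Λ' < Λ ∨ b (j + 1) = 0 then 1 else 0) = 2 * Λ * q := by
  rw [length_mergeGates, map_label_timeDepGates hΛ']
  have hinj : ∀ τ : ℕ → ℝ, Function.Injective fun k : ℕ => (k, τ k) := fun τ k l h =>
    congrArg Prod.fst h
  rw [← numRuns_zigzag_add hq hΛ _ _ (fun j => hinj _) (fun j => hinj _)]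
  refine congrArg₂ (· + ·) (congrArg₂ (· + ·) rfl ?_) ?_
  · refine Finset.sum_congr rfl fun j hj => ?_
    have hj' := Finset.mem_range.1 hj
    have h1 : nodeR q a b 1 (j + 1) = nodeR q a b 1 (j + 2) ↔ a (j + 2) = 0 := by
      rw [← coeffD_add_coeffC_succ a b (j + 1), nodeR_eq, nodeR_eq,
        nodeL_eq (show j + 1 + 1 ≤ q by omega)]
      constructor <;> intro h <;> linarith
    by_cases h2 : 1 ≤ Λ'
    · simp [h2]
    · simp [h2, h1]
  · refine Finset.sum_congr rfl fun j hj => ?_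
    have hj' := Finset.mem_range.1 hj
    have h1 : nodeL q a b 1 (j + 1) = nodeL q a b 1 (j + 2) ↔ b (j + 1) = 0 := by
      rw [← coeffC_add_coeffD a b (show 1 ≤ j + 1 by omega),
        nodeL_eq (show j + 1 ≤ q by omega)]
      constructor <;> intro h <;> linarith
    by_cases h2 : Λ' < Λ
    · simp [h2, Nat.not_le.2 h2]
    · simp [h2, h1, show Λ ≤ Λ' by omega]

theorem numRuns_zigzag_eq {q Λ : ℕ} (hq : 1 ≤ q) (hΛ : 1 ≤ Λ) :
    numRuns ((List.range' 1 q).flatMap fun _ => List.range' 1 Λ ++ (List.range' 1 Λ).reverse) =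
      2 * Λ * q - (2 * q - 1) := by
  have h := numRuns_zigzag_add hq hΛ (fun _ k => k) (fun _ k => k)
    (fun _ => Function.injective_id) (fun _ => Function.injective_id)
  simp at h
  omega

theorem length_mergeGates_timeIndepGates {q Λ : ℕ} (hq : 1 ≤ q) (hΛ : 1 ≤ Λ) (a b : ℕ → ℝ) :
    (mergeGates (timeIndepGates q Λ a b)).length = 2 * Λ * q - (2 * q - 1) := by
  rw [length_mergeGates, ← numRuns_zigzag_eq hq hΛ, timeIndepGates, List.map_flatMap]
  simp [Function.comp_def]

theorem length_mergeGates_separableGates {q Λ Λ' : ℕ} (hq : 1 ≤ q) (hΛ : 1 ≤ Λ) (hΛ' : Λ' ≤ Λ)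
    (a b : ℕ → ℝ) (f : ℕ → ℝ → ℝ) (t Δt : ℝ) :
    (mergeGates (separableGates f (atStep t Δt (timeDepGates q Λ Λ' a b)))).length =
      2 * Λ * q - (2 * q - 1) := by
  have h1 : (separableGates f (atStep t Δt (timeDepGates q Λ Λ' a b))).map Gate.label =
      ((timeDepGates q Λ Λ' a b).map Gate.label).map Prod.fst := by
    simp [separableGates, atStep, Function.comp_def]
  rw [length_mergeGates, h1, map_label_timeDepGates hΛ', ← numRuns_zigzag_eq hq hΛ,
    List.map_flatMap]
  simp [Function.comp_def]

end Counting

/-! ### Operators of merged circuits -/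

section Merging

variable {ι : Type*}

/-- A property of gates that passes from two gates with the same generator to their merger passes
from a circuit to the merged circuit. -/
theorem forall_mem_mergeGates {P : ι → ℝ → Prop} (hadd : ∀ i σ τ, P i σ → P i τ → P i (σ + τ))
    {l : List (Gate ι)} (hl : ∀ g ∈ l, P g.label g.duration) :
    ∀ g ∈ mergeGates l, P g.label g.duration := by
  induction l with
  | nil => simp [mergeGates]
  | cons g l ih =>
    have h1 : mergeGates (g :: l) = consGate g (mergeGates l) := rfl
    have ih' := ih fun g' hg' => hl g' (by simp [hg'])
    have hg := hl g (by simp)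
    rw [h1]
    cases h2 : mergeGates l with
    | nil => simpa [consGate] using hg
    | cons g' m =>
      rw [h2] at ih'
      by_cases h3 : g.label = g'.label
      · have h4 := hadd _ _ _ hg (h3 ▸ ih' g' (by simp))
        simp only [consGate, h3, if_true, List.mem_cons, forall_eq_or_imp]
        exact ⟨h3 ▸ h4, fun g'' hg'' => ih' g'' (by simp [hg''])⟩
      · simp only [consGate, h3, if_false, List.mem_cons, forall_eq_or_imp]
        exact ⟨hg, ih' g' (by simp), fun g'' hg'' => ih' g'' (by simp [hg''])⟩

variable {𝓗 : Type*} [NormedAddCommGroup 𝓗] [InnerProductSpace ℂ 𝓗]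

theorem runGates_append (G : ι → 𝓗 →L[ℂ] 𝓗) (l m : List (Gate ι)) :
    runGates G (l ++ m) = runGates G l * runGates G m := by
  simp [runGates]

theorem runGates_flatMap (G : ι → 𝓗 →L[ℂ] 𝓗) (q : ℕ) (X : ℕ → List (Gate ι)) :
    runGates G ((List.range' 1 q).flatMap X) = forwardProd 1 q fun j => runGates G (X j) := by
  rw [forwardProd, Nat.add_sub_cancel]
  induction List.range' 1 q with
  | nil => simp [runGates]
  | cons j l ih => rw [List.flatMap_cons, runGates_append, ih, List.map_cons, List.prod_cons]

/-- Merging does not change the operator, even if afterwards the generators are renamed and the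
durations rescaled. -/
theorem runGates_map_mergeGates [CompleteSpace 𝓗] {κ : Type*} (G : κ → 𝓗 →L[ℂ] 𝓗) (σ : ι → κ)
    (c : ℝ) (l : List (Gate ι)) :
    runGates G ((mergeGates l).map fun g => ⟨σ g.label, g.duration * c⟩) =
      runGates G (l.map fun g => ⟨σ g.label, g.duration * c⟩) := by
  induction l with
  | nil => rfl
  | cons g l ih =>
    have h1 : mergeGates (g :: l) = consGate g (mergeGates l) := rfl
    have h2 : ∀ (g : Gate κ) (m : List (Gate κ)),
        runGates G (g :: m) = evolve (G g.label) g.duration * runGates G m := fun g m => by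
      simp [runGates]
    rw [h1, List.map_cons, h2, ← ih]
    cases h3 : mergeGates l with
    | nil => simp [consGate, runGates]
    | cons g' m =>
      by_cases h4 : g.label = g'.label
      · simp only [consGate, h4, if_true, List.map_cons, h2, add_mul, evolve_add, mul_assoc]
      · simp only [consGate, h4, if_false, List.map_cons, h2]

theorem runGates_mergeGates [CompleteSpace 𝓗] (G : ι → 𝓗 →L[ℂ] 𝓗) (l : List (Gate ι)) :
    runGates G (mergeGates l) = runGates G l := by
  simpa using runGates_map_mergeGates G id 1 l

end Merging

section Schemes

variable {𝓗 : Type*} [NormedAddCommGroup 𝓗] [InnerProductSpace ℂ 𝓗]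

theorem nodeL_eq_mul (q : ℕ) (a b : ℕ → ℝ) (Δt : ℝ) (k : ℕ) :
    nodeL q a b Δt k = nodeL q a b 1 k * Δt := by
  rw [nodeL, nodeL, one_mul, mul_comm]

theorem nodeR_eq_mul (q : ℕ) (a b : ℕ → ℝ) (Δt : ℝ) (k : ℕ) :
    nodeR q a b Δt k = nodeR q a b 1 k * Δt := by
  rw [nodeR, nodeR, one_mul, mul_comm]

theorem runGates_atStep_gatesF (Λ Λ' : ℕ) (H : ℕ → ℝ → 𝓗 →L[ℂ] 𝓗) (t Δt x y : ℝ) :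
    runGates (Function.uncurry H) (atStep t Δt (gatesF Λ Λ' x y)) =
      blockF Λ Λ' H (t + x * Δt) (t + y * Δt) := by
  have h : t + x * Δt - (t + y * Δt) = (x - y) * Δt := by ring
  simp [runGates, atStep, gatesF, blockF, forwardProd, Function.comp_def, h]

theorem runGates_atStep_gatesB (Λ Λ' : ℕ) (H : ℕ → ℝ → 𝓗 →L[ℂ] 𝓗) (t Δt x y : ℝ) :
    runGates (Function.uncurry H) (atStep t Δt (gatesB Λ Λ' x y)) =
      blockB Λ Λ' H (t + x * Δt) (t + y * Δt) := by
  have h : t + x * Δt - (t + y * Δt) = (x - y) * Δt := by ring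
  simp [runGates, atStep, gatesB, blockB, backwardProd, Function.comp_def, h]

theorem runGates_atStep_timeDepGates (q Λ Λ' : ℕ) (a b : ℕ → ℝ) (H : ℕ → ℝ → 𝓗 →L[ℂ] 𝓗)
    (t Δt : ℝ) :
    runGates (Function.uncurry H) (atStep t Δt (timeDepGates q Λ Λ' a b)) =
      timeDepScheme q Λ Λ' a b H t Δt := by
  rw [timeDepGates, atStep, List.map_flatMap, runGates_flatMap, timeDepScheme]
  refine congrArg (forwardProd 1 q) (funext fun j => ?_)
  rw [List.map_append, runGates_append, nodeL_eq_mul q a b Δt j, nodeR_eq_mul q a b Δt j,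
    nodeL_eq_mul q a b Δt (j + 1),
    ← runGates_atStep_gatesF, ← runGates_atStep_gatesB]
  rfl

theorem runGates_scaleGates_timeIndepGates (q Λ : ℕ) (a b : ℕ → ℝ) (h : ℕ → 𝓗 →L[ℂ] 𝓗) (Δt : ℝ) :
    runGates h (scaleGates Δt (timeIndepGates q Λ a b)) = timeIndepScheme q Λ a b h Δt := by
  rw [timeIndepGates, scaleGates, List.map_flatMap, runGates_flatMap, timeIndepScheme]
  refine congrArg (forwardProd 1 q) (funext fun j => ?_)
  rw [List.map_append, runGates_append]
  simp [runGates, forwardProd, backwardProd, Function.comp_def]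

theorem label_mem_of_mem_timeDepGates {q Λ Λ' : ℕ} (hΛ' : Λ' ≤ Λ) (a b : ℕ → ℝ)
    {g : Gate (ℕ × ℝ)} (hg : g ∈ timeDepGates q Λ Λ' a b) : g.label.1 ∈ Finset.Icc 1 Λ := by
  have h1 := List.mem_map_of_mem (f := Gate.label) hg
  rw [map_label_timeDepGates hΛ', List.mem_flatMap] at h1
  obtain ⟨j, _, h2⟩ := h1
  rw [Finset.mem_Icc]
  simp only [List.mem_append, List.mem_map, List.mem_reverse, List.mem_range'_1] at h2
  rcases h2 with ⟨k, hk, h3⟩ | ⟨k, hk, h3⟩ <;> rw [← h3] <;> simp only <;> omega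

theorem evolve_smul (A : 𝓗 →L[ℂ] 𝓗) (r τ : ℝ) : evolve ((r : ℂ) • A) τ = evolve A (τ * r) := by
  rw [evolve, evolve, smul_smul]
  congr 2
  push_cast
  ring

/-- A query to `f_k(α) h_k` is a rotation generated by `h_k`. -/
theorem runGates_separableGates {Λ : ℕ} {H : ℕ → ℝ → 𝓗 →L[ℂ] 𝓗} {f : ℕ → ℝ → ℝ}
    {h : ℕ → 𝓗 →L[ℂ] 𝓗} (hf : ∀ k ∈ Finset.Icc 1 Λ, ∀ s : ℝ, H k s = (f k s : ℂ) • h k)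
    {l : List (Gate (ℕ × ℝ))} (hl : ∀ g ∈ l, g.label.1 ∈ Finset.Icc 1 Λ) :
    runGates h (separableGates f l) = runGates (Function.uncurry H) l := by
  rw [runGates, runGates, separableGates, List.map_map]
  refine congrArg List.prod (List.map_congr_left fun g hg => ?_)
  simp only [Function.comp, Function.uncurry]
  rw [hf _ (hl g hg), evolve_smul]

/-- The rotation angles that one query of `f(α) h` can realize are closed under addition: either
`f` vanishes identically and they are all `0`, or every angle is realized. -/
theorem exists_mul_eq_add {f : ℝ → ℝ} {σ τ : ℝ} (hσ : ∃ s α, σ = s * f α)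
    (hτ : ∃ s α, τ = s * f α) : ∃ s α, σ + τ = s * f α := by
  by_cases h : ∃ α, f α ≠ 0
  · obtain ⟨α, hα⟩ := h
    exact ⟨(σ + τ) / f α, α, (div_mul_cancel₀ _ hα).symm⟩
  · push Not at h
    obtain ⟨s, α, rfl⟩ := hσ
    obtain ⟨s', α', rfl⟩ := hτ
    exact ⟨0, 0, by simp [h]⟩

/-- A circuit of gates `e^{-iθ h_k}` whose angles are each realized by some query can be implemented
by the same number of queries to the `H_k = f_k h_k`. -/
theorem exists_queries_of_separable {Λ : ℕ} {H : ℕ → ℝ → 𝓗 →L[ℂ] 𝓗} {f : ℕ → ℝ → ℝ}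
    {h : ℕ → 𝓗 →L[ℂ] 𝓗} (hf : ∀ k ∈ Finset.Icc 1 Λ, ∀ s : ℝ, H k s = (f k s : ℂ) • h k)
    (l : List (Gate ℕ))
    (hl : ∀ g ∈ l, g.label ∈ Finset.Icc 1 Λ ∧ ∃ s α, g.duration = s * f g.label α) :
    ∃ m : List (Gate (ℕ × ℝ)), (∀ g ∈ m, g.label.1 ∈ Finset.Icc 1 Λ) ∧ m.length = l.length ∧
      runGates (Function.uncurry H) m = runGates h l := by
  induction l with
  | nil => exact ⟨[], by simp, rfl, rfl⟩
  | cons g l ih =>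
    obtain ⟨m, hm1, hm2, hm3⟩ := ih fun g' hg' => hl g' (by simp [hg'])
    obtain ⟨hg, s, α, hs⟩ := hl g (by simp)
    refine ⟨⟨(g.label, α), s⟩ :: m, ?_, by simp [hm2], ?_⟩
    · simp only [List.mem_cons, forall_eq_or_imp]
      exact ⟨hg, hm1⟩
    · simp only [runGates, List.map_cons, List.prod_cons] at hm3 ⊢
      rw [hm3, hs, Function.uncurry_apply_pair, hf _ hg, evolve_smul]

/-- A time-dependent formula, applied to constant Hamiltonians, is a time-independent formula with
the same number of gates. -/
theorem IsTimeDepFormula.exists_timeIndep {n Λ : ℕ} {l : List (Gate (ℕ × ℝ))}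
    (hl : IsTimeDepFormula n Λ l) : ∃ m, IsTimeIndepFormula n Λ m ∧ m.length = l.length := by
  refine ⟨l.map fun g => ⟨g.label.1, g.duration⟩, ⟨?_, fun m h hh => ?_⟩, by simp⟩
  · intro g hg
    obtain ⟨g', hg', rfl⟩ := List.mem_map.1 hg
    exact hl.1 g' hg'
  · have h1 := hl.2 m (fun k _ => h k) (fun k hk => ⟨contDiff_const, fun _ => hh k hk⟩) 0
    have ht : Tendsto (fun x : ℝ => ((0 : ℝ), x)) (𝓝 0) (𝓝 (0, 0)) := by
      have : Continuous fun x : ℝ => ((0 : ℝ), x) := by fun_prop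
      exact this.tendsto 0
    refine (h1.comp_tendsto ht).congr_left fun x => ?_
    simp only [Function.comp]
    rw [timeOrderedExp_const, zero_add, sub_zero]
    simp [runGates, atStep, scaleGates, Function.comp_def, Function.uncurry]

theorem timeDepScheme_eq_midpointScheme {q Λ : ℕ} {a b : ℕ → ℝ}
    (hcd : ∀ j ∈ Finset.Icc 1 q, coeffC a b j = coeffD a b j) (H : ℕ → ℝ → 𝓗 →L[ℂ] 𝓗)
    (t Δt : ℝ) :
    timeDepScheme q Λ 0 a b H t Δt = forwardProd 1 q fun j =>
      midpointScheme Λ H (t + nodeL q a b Δt j) (t + nodeL q a b Δt (j + 1)) := by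
  refine forwardProd_congr fun j hj1 hj2 => ?_
  have h1 := nodeL_eq hj2 a b Δt
  have h2 := nodeR_eq q a b Δt j
  have h3 := hcd j (Finset.mem_Icc.2 ⟨hj1, hj2⟩)
  have h4 : (t + nodeL q a b Δt (j + 1) + (t + nodeL q a b Δt j)) / 2 = t + nodeR q a b Δt j := by
    rw [h1, h2, h3]
    ring
  have h5 : t + nodeL q a b Δt j - (t + nodeR q a b Δt j) =
      (t + nodeL q a b Δt j - (t + nodeL q a b Δt (j + 1))) / 2 := by
    rw [h1, h2, h3]
    ring
  have h6 : t + nodeR q a b Δt j - (t + nodeL q a b Δt (j + 1)) =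
      (t + nodeL q a b Δt j - (t + nodeL q a b Δt (j + 1))) / 2 := by
    rw [h1, h2, h3]
    ring
  rw [blockF, blockB, midpointScheme, h4, h5, h6]
  simp [forwardProd, backwardProd]

theorem timeDepScheme_frs [CompleteSpace 𝓗] (H : ℕ → ℝ → 𝓗 →L[ℂ] 𝓗) (t Δt : ℝ) :
    timeDepScheme 3 2 1 frsA frsB H t Δt =
      evolve (H 1 (t + Δt)) (frsGamma * Δt / 2) *
      evolve (H 2 (t + (1 - frsGamma / 2) * Δt)) (frsGamma * Δt) *
      evolve (H 1 (t + (1 - frsGamma) * Δt)) ((1 - frsGamma) * Δt / 2) *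
      evolve (H 2 (t + Δt / 2)) ((1 - 2 * frsGamma) * Δt) *
      evolve (H 1 (t + frsGamma * Δt)) ((1 - frsGamma) * Δt / 2) *
      evolve (H 2 (t + frsGamma * Δt / 2)) (frsGamma * Δt) *
      evolve (H 1 t) (frsGamma * Δt / 2) := by
  have hF : ∀ x y, blockF 2 1 H x y = evolve (H 1 x) (x - y) * evolve (H 2 y) (x - y) :=
    fun x y => by simp [blockF, forwardProd]
  have hB : ∀ x y, blockB 2 1 H x y = evolve (H 2 x) (x - y) * evolve (H 1 y) (x - y) :=
    fun x y => by simp [blockB, backwardProd]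
  have hm : ∀ (A C : 𝓗 →L[ℂ] 𝓗) (σ τ : ℝ),
      evolve A σ * (evolve A τ * C) = evolve A (σ + τ) * C := fun A C σ τ => by
    rw [evolve_add, mul_assoc]
  have hd1 : coeffD frsA frsB 1 = frsGamma / 2 := by simp [coeffD, frsA, frsB]; ring
  have hd2 : coeffD frsA frsB 2 = (1 - 2 * frsGamma) / 2 := by
    rw [coeffD, hd1]; simp [frsA, frsB]; ring
  have hd3 : coeffD frsA frsB 3 = frsGamma / 2 := by
    rw [coeffD, hd2]; simp [frsA, frsB]; ring
  have hc1 : coeffC frsA frsB 1 = frsGamma / 2 := by simp [coeffC, coeffD, frsA]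
  have hc2 : coeffC frsA frsB 2 = (1 - 2 * frsGamma) / 2 := by
    rw [coeffC, hd1]; simp [frsA]; ring
  have hc3 : coeffC frsA frsB 3 = frsGamma / 2 := by
    rw [coeffC, hd2]; simp [frsA]; ring
  have hL4 : nodeL 3 frsA frsB Δt 4 = 0 := by simp [nodeL]
  have hL3 : nodeL 3 frsA frsB Δt 3 = frsGamma * Δt := by
    rw [nodeL_eq le_rfl, hL4, hc3, hd3]; ring
  have hL2 : nodeL 3 frsA frsB Δt 2 = (1 - frsGamma) * Δt := by
    rw [nodeL_eq (by norm_num), hL3, hc2, hd2]; ring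
  have hL1 : nodeL 3 frsA frsB Δt 1 = Δt := by
    rw [nodeL_eq (by norm_num), hL2, hc1, hd1]; ring
  have hR3 : nodeR 3 frsA frsB Δt 3 = frsGamma * Δt / 2 := by
    rw [nodeR_eq, hL4, hd3]; ring
  have hR2 : nodeR 3 frsA frsB Δt 2 = Δt / 2 := by
    rw [nodeR_eq, hL3, hd2]; ring
  have hR1 : nodeR 3 frsA frsB Δt 1 = (1 - frsGamma / 2) * Δt := by
    rw [nodeR_eq, hL2, hd1]; ring
  simp only [timeDepScheme, forwardProd, List.range', List.map_cons, List.map_nil, List.prod_cons,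
    List.prod_nil, mul_one, hF, hB, Nat.reduceAdd, Nat.reduceSub, hL1, hL2, hL3, hL4, hR1, hR2, hR3,
    mul_assoc, hm, add_zero]
  congr <;> ring

end Schemes

/-! ### Order and size of the merged circuits -/

section MergedCircuits

theorem runGates_atStep_mergeGates_timeDepGates {𝓗 : Type*} [NormedAddCommGroup 𝓗]
    [InnerProductSpace ℂ 𝓗] [CompleteSpace 𝓗] (q Λ Λ' : ℕ) (a b : ℕ → ℝ) (H : ℕ → ℝ → 𝓗 →L[ℂ] 𝓗)
    (t Δt : ℝ) :
    runGates (Function.uncurry H) (atStep t Δt (mergeGates (timeDepGates q Λ Λ' a b))) =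
      timeDepScheme q Λ Λ' a b H t Δt := by
  rw [← runGates_atStep_timeDepGates]
  exact runGates_map_mergeGates _ (fun i : ℕ × ℝ => (i.1, t + i.2 * Δt)) Δt _

theorem isTimeDepFormula_mergeGates {n q Λ Λ' : ℕ} (hn : 1 ≤ n) (hΛ' : Λ' ≤ Λ) {a b : ℕ → ℝ}
    (hab : IsProductFormulaOfOrder n q a b) :
    IsTimeDepFormula n Λ (mergeGates (timeDepGates q Λ Λ' a b)) := by
  refine ⟨forall_mem_mergeGates (P := fun i _ => i.1 ∈ Finset.Icc 1 Λ) (fun _ _ _ h _ => h)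
    fun g hg => label_mem_of_mem_timeDepGates hΛ' a b hg, fun m H hH => ?_⟩
  simp only [runGates_atStep_mergeGates_timeDepGates]
  exact approximatesToOrder_timeDepScheme hn hΛ' hab H fun k hk => (hH k hk).1

theorem length_mergeGates_timeDepGates_of_lt {q Λ Λ' : ℕ} (hq : 1 ≤ q) (h0 : Λ' ≠ 0)
    (hΛ' : Λ' < Λ) (a b : ℕ → ℝ) :
    (mergeGates (timeDepGates q Λ Λ' a b)).length = 2 * Λ * q - (2 * q - 1) := by
  have h := length_mergeGates_timeDepGates hq (by omega) hΛ'.le a b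
  simp only [show 1 ≤ Λ' by omega, hΛ', true_or, if_true, Finset.sum_const, Finset.card_range,
    smul_eq_mul, mul_one] at h
  omega

theorem length_mergeGates_timeDepGates_zero {q Λ : ℕ} (hq : 1 ≤ q) (hΛ : 1 ≤ Λ) (a b : ℕ → ℝ) :
    (mergeGates (timeDepGates q Λ 0 a b)).length ≤ 2 * Λ * q - q ∧
      ((∀ j ∈ Finset.Icc 2 q, a j ≠ 0) →
        (mergeGates (timeDepGates q Λ 0 a b)).length = 2 * Λ * q - q) := by
  classical
  have h := length_mergeGates_timeDepGates hq hΛ (Nat.zero_le Λ) a b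
  simp only [show 0 < Λ by omega, true_or, if_true, Finset.sum_const, Finset.card_range,
    smul_eq_mul, mul_one] at h
  refine ⟨by omega, fun ha => ?_⟩
  rw [Finset.sum_eq_zero fun j hj => ?_] at h
  · omega
  · have hj' := Finset.mem_range.1 hj
    simp [ha (j + 2) (Finset.mem_Icc.2 (by omega))]

theorem length_mergeGates_timeDepGates_self {q Λ : ℕ} (hq : 1 ≤ q) (hΛ : 1 ≤ Λ) (a b : ℕ → ℝ) :
    (mergeGates (timeDepGates q Λ Λ a b)).length ≤ 2 * Λ * q - (q - 1) ∧
      ((∀ j ∈ Finset.Icc 1 q, b j ≠ 0) →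
        (mergeGates (timeDepGates q Λ Λ a b)).length = 2 * Λ * q - (q - 1)) := by
  classical
  have h := length_mergeGates_timeDepGates hq hΛ le_rfl a b
  simp only [hΛ, true_or, if_true, Finset.sum_const, Finset.card_range,
    smul_eq_mul, mul_one] at h
  refine ⟨by omega, fun hb => ?_⟩
  rw [Finset.sum_eq_zero (s := Finset.range q) fun j hj => ?_] at h
  · omega
  · have hj' := Finset.mem_range.1 hj
    simp [hb (j + 1) (Finset.mem_Icc.2 (by omega))]

end MergedCircuits

theorem mainTheorem2
    (n q Λ Λ' : ℕ) (hn : 1 ≤ n) (hq : 1 ≤ q) (hΛ : 1 ≤ Λ) (hΛ' : Λ' ≤ Λ)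
    (a b : ℕ → ℝ) (hab : IsProductFormulaOfOrder n q a b)
    {𝓗 : Type*} [NormedAddCommGroup 𝓗] [InnerProductSpace ℂ 𝓗] [CompleteSpace 𝓗]
    (H : ℕ → ℝ → 𝓗 →L[ℂ] 𝓗) (hH : ∀ k ∈ Finset.Icc 1 Λ, ContDiff ℝ ∞ (H k)) :
    -- order of approximation
    ApproximatesToOrder n Λ H (timeDepScheme q Λ Λ' a b H) ∧
    -- the merged circuits implement the schemes
    (∀ t Δt : ℝ,
      runGates (Function.uncurry H) (atStep t Δt (mergeGates (timeDepGates q Λ Λ' a b))) =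
        timeDepScheme q Λ Λ' a b H t Δt) ∧
    (∀ (h : ℕ → 𝓗 →L[ℂ] 𝓗) (Δt : ℝ),
      runGates h (scaleGates Δt (mergeGates (timeIndepGates q Λ a b))) =
        timeIndepScheme q Λ a b h Δt) ∧
    -- number of gates: time-independent scheme
    (mergeGates (timeIndepGates q Λ a b)).length = 2 * Λ * q - (2 * q - 1) ∧
    -- number of gates: time-dependent scheme
    (Λ' ≠ 0 → Λ' ≠ Λ →
      (mergeGates (timeDepGates q Λ Λ' a b)).length = 2 * Λ * q - (2 * q - 1)) ∧
    (Λ' = 0 →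
      (mergeGates (timeDepGates q Λ Λ' a b)).length ≤ 2 * Λ * q - q ∧
      ((∀ j ∈ Finset.Icc 2 q, a j ≠ 0) →
        (mergeGates (timeDepGates q Λ Λ' a b)).length = 2 * Λ * q - q)) ∧
    (Λ' = Λ →
      (mergeGates (timeDepGates q Λ Λ' a b)).length ≤ 2 * Λ * q - (q - 1) ∧
      ((∀ j ∈ Finset.Icc 1 q, b j ≠ 0) →
        (mergeGates (timeDepGates q Λ Λ' a b)).length = 2 * Λ * q - (q - 1))) ∧
    -- number of gates: digitized adiabatic simulation
    (∀ (f : ℕ → ℝ → ℝ) (h : ℕ → 𝓗 →L[ℂ] 𝓗),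
      (∀ k ∈ Finset.Icc 1 Λ, ∀ s : ℝ, H k s = (f k s : ℂ) • h k) →
      ∀ t Δt : ℝ,
        (mergeGates (separableGates f (atStep t Δt (timeDepGates q Λ Λ' a b)))).length =
            2 * Λ * q - (2 * q - 1) ∧
        runGates h (mergeGates (separableGates f (atStep t Δt (timeDepGates q Λ Λ' a b)))) =
            timeDepScheme q Λ Λ' a b H t Δt ∧
        ∃ l : List (Gate (ℕ × ℝ)), (∀ g ∈ l, g.label.1 ∈ Finset.Icc 1 Λ) ∧
          l.length = 2 * Λ * q - (2 * q - 1) ∧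
          runGates (Function.uncurry H) l = timeDepScheme q Λ Λ' a b H t Δt) ∧
    -- a time-independent formula with the minimum number of gates gives a time-dependent one
    (Λ' ≠ 0 → Λ' ≠ Λ →
      IsTimeDepFormula n Λ (mergeGates (timeDepGates q Λ Λ' a b)) ∧
      (IsLeast {N : ℕ | ∃ l, IsTimeIndepFormula n Λ l ∧ l.length = N}
          (2 * Λ * q - (2 * q - 1)) →
        IsLeast {N : ℕ | ∃ l, IsTimeDepFormula n Λ l ∧ l.length = N}
          (2 * Λ * q - (2 * q - 1)))) ∧
    -- Suzuki's scheme
    (Λ' = 0 → (∀ j ∈ Finset.Icc 1 q, coeffC a b j = coeffD a b j) →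
      ∀ t Δt : ℝ, timeDepScheme q Λ Λ' a b H t Δt =
        forwardProd 1 q fun j =>
          midpointScheme Λ H (t + nodeL q a b Δt j) (t + nodeL q a b Δt (j + 1))) ∧
    -- the seven-gate formula for two local terms
    (∀ t Δt : ℝ, timeDepScheme 3 2 1 frsA frsB H t Δt =
      evolve (H 1 (t + Δt)) (frsGamma * Δt / 2) *
      evolve (H 2 (t + (1 - frsGamma / 2) * Δt)) (frsGamma * Δt) *
      evolve (H 1 (t + (1 - frsGamma) * Δt)) ((1 - frsGamma) * Δt / 2) *
      evolve (H 2 (t + Δt / 2)) ((1 - 2 * frsGamma) * Δt) *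
      evolve (H 1 (t + frsGamma * Δt)) ((1 - frsGamma) * Δt / 2) *
      evolve (H 2 (t + frsGamma * Δt / 2)) (frsGamma * Δt) *
      evolve (H 1 t) (frsGamma * Δt / 2)) ∧
    (mergeGates (timeDepGates 3 2 1 frsA frsB)).length = 7 := by
  refine ⟨approximatesToOrder_timeDepScheme hn hΛ' hab H hH,
    runGates_atStep_mergeGates_timeDepGates q Λ Λ' a b H, fun h Δt => ?_,
    length_mergeGates_timeIndepGates hq hΛ a b,
    fun h0 h1 => length_mergeGates_timeDepGates_of_lt hq h0 (lt_of_le_of_ne hΛ' h1) a b, ?_, ?_,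
    fun f h hf t Δt => ?_, fun h0 h1 => ⟨isTimeDepFormula_mergeGates hn hΛ' hab, fun hmin => ?_⟩,
    ?_, timeDepScheme_frs H,
    length_mergeGates_timeDepGates_of_lt (by norm_num) (by norm_num) (by norm_num) _ _⟩
  · rw [← runGates_scaleGates_timeIndepGates]
    exact runGates_map_mergeGates _ id Δt _
  · rintro rfl
    exact length_mergeGates_timeDepGates_zero hq hΛ a b
  · rintro rfl
    exact length_mergeGates_timeDepGates_self hq hΛ a b
  · have hlabel : ∀ g ∈ atStep t Δt (timeDepGates q Λ Λ' a b), g.label.1 ∈ Finset.Icc 1 Λ := by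
      intro g hg
      obtain ⟨g', hg', rfl⟩ := List.mem_map.1 hg
      have hmem := label_mem_of_mem_timeDepGates hΛ' a b hg'
      exact hmem
    have hlen := length_mergeGates_separableGates hq hΛ hΛ' a b f t Δt
    have hop : runGates h (mergeGates (separableGates f (atStep t Δt (timeDepGates q Λ Λ' a b)))) =
        timeDepScheme q Λ Λ' a b H t Δt := by
      rw [runGates_mergeGates, runGates_separableGates hf hlabel, runGates_atStep_timeDepGates]
    refine ⟨hlen, hop, ?_⟩
    obtain ⟨m, hm1, hm2, hm3⟩ := exists_queries_of_separable hf _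
      (forall_mem_mergeGates (l := separableGates f (atStep t Δt (timeDepGates q Λ Λ' a b)))
        (P := fun k θ => k ∈ Finset.Icc 1 Λ ∧ ∃ s α, θ = s * f k α)
        (fun k σ τ hσ hτ => ⟨hσ.1, exists_mul_eq_add hσ.2 hτ.2⟩) fun g hg => by
          obtain ⟨g', hg', rfl⟩ := List.mem_map.1 hg
          exact ⟨hlabel g' hg', g'.duration, g'.label.2, rfl⟩)
    exact ⟨m, hm1, hm2.trans hlen, hm3.trans hop⟩
  · refine ⟨⟨_, isTimeDepFormula_mergeGates hn hΛ' hab,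
      length_mergeGates_timeDepGates_of_lt hq h0 (lt_of_le_of_ne hΛ' h1) a b⟩, ?_⟩
    rintro N ⟨l, hl, rfl⟩
    obtain ⟨m, hm, hlen⟩ := hl.exists_timeIndep
    exact hmin.2 ⟨m, hm, hlen⟩
  · rintro rfl hcd t Δt
    exact timeDepScheme_eq_midpointScheme hcd H t Δt
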